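/- Let $\Gamma$ be a countable discrete group, $\Delta\Gamma$ its Stone--\v{C}ech compactification (the space of ultrafilters on $\Gamma$) and $\partial\Gamma=\Delta\Gamma\setminus\Gamma$. Let $X$ be a non-empty boundary piece of $\Gamma$, i.e. a non-empty closed subset $X\subset\partial\Gamma$ that is invariant under the left and right actions of $\Gamma$. Let $\operatorname{Prob}(\Gamma)$ be the set of probability measures on $\Gamma$, with left action $(s\cdot p)(g)=p(s^{-1}g)$ and the topology of pointwise convergence (equivalently, of $\|\cdot\|_1$). A continuous action of $\Gamma$ on a compact Hausdorff space $K$ is called amenable if there is a net of continuous maps $P_n:K\to\operatorname{Prob}(\Gamma)$ with $\lim_n\sup_{x\in K}\|P_n(gx)-g\cdot P_n(x)\|_1=0$ for all $g\in\Gamma$. The group $\Gamma$ is exact if its reduced C*-algebra $C^*_\lambda(\Gamma)$ is exact, i.e. admits a faithful representation $\pi:C^*_\lambda(\Gamma)\to B(H)$ that is a point-norm limit of compositions $C^*_\lambda(\Gamma)\to M_{k}(\mathbb C)\to B(H)$ of contractive completely positive maps. The following are equivalent. (i) $\Gamma$ is bi-exact towards $X$: the action of $\Gamma$ on the Gelfand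 spectrum of the C*-algebra $C(X)^{\Gamma_r}=\{f\in C(X) : f(\omega t)=f(\omega)\text{ for all }t\in\Gamma,\ \omega\in X\}$ induced by left translation is amenable. (ii) There exist a compact Hausdorff space $K$, an amenable continuous action $\Gamma\curvearrowright K$ and a regular Borel probability measure $\eta$ on $K$ such that $X\subset\partial_\eta\Gamma$, where $\partial_\eta\Gamma$ is the set of $\omega\in\Delta\Gamma$ such that for all $h\in\Gamma$, $\lim_{g\to\omega}\big((gh)\cdot\eta-g\cdot\eta\big)=0$ in the weak-* topology. (iii) $\Gamma$ is exact and there is a map $\mu:\Gamma\to\operatorname{Prob}(\Gamma)$ such that $\lim_{g\to\omega}\|\mu(sgt)-s\cdot\mu(g)\|_1=0$ for all $s,t\in\Gamma$ and $\omega\in X$. -/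

import Mathlib

open Filter Topology MeasureTheory
open scoped ComplexOrder CStarAlgebra

universe u

noncomputable section

/-! ### Probability measures on a discrete group -/

/-- `Prob(Γ)` for a discrete set `Γ`: nonnegative functions of total mass one. It carries the
topology of pointwise convergence, which on `Prob(Γ)` coincides with the `ℓ¹`-norm topology. -/
abbrev DiscreteProb (Γ : Type u) : Type u :=
  {p : Γ → ℝ // (∀ g, 0 ≤ p g) ∧ HasSum p 1}

namespace DiscreteProb

variable {Γ : Type u}

/-- The distance `‖p - q‖₁`. -/
def l1Dist (p q : DiscreteProb Γ) : ℝ := ∑' g, |p.1 g - q.1 g|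

theorem summable_abs_sub (p q : DiscreteProb Γ) : Summable fun g => |p.1 g - q.1 g| :=
  (p.2.2.summable.sub q.2.2.summable).abs

/-- The left translate `s · p`, that is, `(s · p)(g) = p(s⁻¹ g)`. -/
def translate [Group Γ] (s : Γ) (p : DiscreteProb Γ) : DiscreteProb Γ :=
  ⟨fun g => p.1 (s⁻¹ * g), fun _ => p.2.1 _,
    (Equiv.hasSum_iff (Equiv.mulLeft s⁻¹)).2 p.2.2⟩

end DiscreteProb

/-! ### Amenable actions -/

/-- Amenability of a continuous action of a discrete group `Γ` on a compact space `K`: there is a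
net of continuous maps `P_n : K → Prob(Γ)` with `sup_x ‖P_n (g x) - g · P_n x‖₁ → 0` for every
`g ∈ Γ`. The net is indexed by the pairs `(E, ε)`, `E ⊆ Γ` finite and `ε > 0`. -/
def IsAmenableAction (Γ : Type u) (K : Type*) [Group Γ] [TopologicalSpace K] [CompactSpace K]
    [MulAction Γ K] [ContinuousConstSMul Γ K] : Prop :=
  ∀ (E : Finset Γ) (ε : ℝ), 0 < ε →
    ∃ P : K → DiscreteProb Γ, Continuous P ∧
      ∀ g ∈ E, ∀ x : K,
        DiscreteProb.l1Dist (P (g • x)) (DiscreteProb.translate g (P x)) ≤ ε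

/-! ### Exactness -/

/-- A map between C*-algebras is nuclear if it is a point-norm limit of maps that factor
through matrix algebras by contractive completely positive maps. -/
def IsNuclearMap {A B : Type*} [CStarAlgebra A] [PartialOrder A] [StarOrderedRing A]
    [CStarAlgebra B] [PartialOrder B] [StarOrderedRing B] (θ : A → B) : Prop :=
  ∀ (F : Finset A) (ε : ℝ), 0 < ε →
    ∃ (k : ℕ) (φ : A →CP CStarMatrix (Fin k) (Fin k) ℂ)
      (ψ : CStarMatrix (Fin k) (Fin k) ℂ →CP B),
      (∀ a, ‖φ a‖ ≤ ‖a‖) ∧ (∀ m, ‖ψ m‖ ≤ ‖m‖) ∧ ∀ a ∈ F, ‖ψ (φ a) - θ a‖ < ε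

/-- A unital C*-algebra is exact if it has a faithful representation on a Hilbert space that is
nuclear as a map into the bounded operators. -/
def IsExactCStarAlgebra (A : Type u) [CStarAlgebra A] : Prop :=
  letI : PartialOrder A := CStarAlgebra.spectralOrder A
  letI : StarOrderedRing A := CStarAlgebra.spectralOrderedRing A
  ∃ (H : Type u) (_ : NormedAddCommGroup H) (_ : InnerProductSpace ℂ H) (_ : CompleteSpace H)
    (π : A →⋆ₐ[ℂ] (H →L[ℂ] H)), Function.Injective π ∧ IsNuclearMap π

/-- The Hilbert space `ℓ²(Γ)`. -/
abbrev EllTwo (Γ : Type u) : Type u := lp (fun _ : Γ => ℂ) 2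

theorem memlp_two_translate {Γ : Type u} [Group Γ] (s : Γ) (ξ : EllTwo Γ) :
    Memℓp (fun g => ξ (s⁻¹ * g)) 2 := by
  have h : Summable fun g => ‖ξ g‖ ^ (2 : ENNReal).toReal :=
    (lp.memℓp ξ).summable (by norm_num)
  exact memℓp_gen ((Equiv.summable_iff (Equiv.mulLeft s⁻¹)).2 h)

/-- The left regular representation, `(λ_s ξ)(g) = ξ(s⁻¹ g)`. -/
def leftRegular {Γ : Type u} [Group Γ] (s : Γ) : EllTwo Γ →L[ℂ] EllTwo Γ :=
  LinearIsometry.toContinuousLinearMap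
    { toFun := fun ξ => ⟨fun g => ξ (s⁻¹ * g), memlp_two_translate s ξ⟩
      map_add' := fun _ _ => rfl
      map_smul' := fun _ _ => rfl
      norm_map' := fun ξ => by
        have h2 : (0 : ℝ) < (2 : ENNReal).toReal := by norm_num
        rw [lp.norm_eq_tsum_rpow h2, lp.norm_eq_tsum_rpow h2]
        congr 1
        exact (Equiv.mulLeft s⁻¹).tsum_eq fun g => ‖ξ g‖ ^ (2 : ENNReal).toReal }

theorem leftRegular_apply {Γ : Type u} [Group Γ] (s : Γ) (ξ : EllTwo Γ) (g : Γ) :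
    leftRegular s ξ g = ξ (s⁻¹ * g) := rfl

/-- The reduced group C*-algebra `C*_λ(Γ)`, the norm closed star-subalgebra of `B(ℓ²Γ)` generated
by the left regular representation. -/
def reducedCStar (Γ : Type u) [Group Γ] : StarSubalgebra ℂ (EllTwo Γ →L[ℂ] EllTwo Γ) :=
  (StarAlgebra.adjoin ℂ (Set.range (leftRegular (Γ := Γ)))).topologicalClosure

instance reducedCStar.instIsClosed (Γ : Type u) [Group Γ] :
    IsClosed (reducedCStar Γ : Set (EllTwo Γ →L[ℂ] EllTwo Γ)) :=
  StarSubalgebra.isClosed_topologicalClosure _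

/-- A discrete group is exact if its reduced group C*-algebra is exact. -/
def IsExactGroup (Γ : Type u) [Group Γ] : Prop := IsExactCStarAlgebra (reducedCStar Γ)

/-! ### Boundary pieces -/

/-- A boundary piece of a discrete group `Γ`: a closed subset of the Stone–Čech boundary
`∂Γ = ΔΓ ∖ Γ` that is invariant under the left and right actions of `Γ`. The Stone–Čech
compactification `ΔΓ` of the discrete space `Γ` is the space of ultrafilters on `Γ`, in which
`Γ` sits as the principal ultrafilters. -/
structure BoundaryPiece (Γ : Type u) [Group Γ] where
  /-- The underlying set of points of `ΔΓ`. -/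
  carrier : Set (Ultrafilter Γ)
  isClosed : IsClosed carrier
  ne_pure : ∀ ω ∈ carrier, ∀ g : Γ, ω ≠ pure g
  left_mem : ∀ (s : Γ), ∀ ω ∈ carrier, ω.map (fun g => s * g) ∈ carrier
  right_mem : ∀ (t : Γ), ∀ ω ∈ carrier, ω.map (fun g => g * t) ∈ carrier

theorem continuous_ultrafilter_map {α β : Type*} (f : α → β) :
    Continuous (Ultrafilter.map f) := by
  rw [ultrafilterBasis_is_basis.continuous_iff]
  rintro _ ⟨s, rfl⟩
  exact ultrafilter_isOpen_basic (f ⁻¹' s)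

namespace BoundaryPiece

variable {Γ : Type u} [Group Γ] (X : BoundaryPiece Γ)

instance : CompactSpace X.carrier := isCompact_iff_compactSpace.1 X.isClosed.isCompact

/-- Left translation `ω ↦ s ω` on `X`. -/
def leftMap (s : Γ) : C(X.carrier, X.carrier) where
  toFun ω := ⟨ω.1.map (fun g => s * g), X.left_mem s ω.1 ω.2⟩
  continuous_toFun :=
    ((continuous_ultrafilter_map _).comp continuous_subtype_val).subtype_mk _

/-- Right translation `ω ↦ ω t` on `X`. -/
def rightMap (t : Γ) : C(X.carrier, X.carrier) where
  toFun ω := ⟨ω.1.map (fun g => g * t), X.right_mem t ω.1 ω.2⟩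
  continuous_toFun :=
    ((continuous_ultrafilter_map _).comp continuous_subtype_val).subtype_mk _

theorem leftMap_one (ω : X.carrier) : X.leftMap 1 ω = ω := by
  apply Subtype.ext
  simp [leftMap]

theorem leftMap_mul (s t : Γ) (ω : X.carrier) :
    X.leftMap (s * t) ω = X.leftMap s (X.leftMap t ω) := by
  apply Subtype.ext
  simp [leftMap, Ultrafilter.map_map, Function.comp_def, mul_assoc]

theorem leftMap_rightMap (s t : Γ) (ω : X.carrier) :
    X.leftMap s (X.rightMap t ω) = X.rightMap t (X.leftMap s ω) := by
  apply Subtype.ext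
  simp [leftMap, rightMap, Ultrafilter.map_map, Function.comp_def, mul_assoc]

/-- The C*-algebra `C(X)^{Γ_r}` of right-invariant continuous functions on `X`. -/
def rightInvariant : StarSubalgebra ℂ C(X.carrier, ℂ) where
  carrier := {f | ∀ (t : Γ) (ω : X.carrier), f (X.rightMap t ω) = f ω}
  mul_mem' ha hb t ω := by simp [ha t ω, hb t ω]
  add_mem' ha hb t ω := by simp [ha t ω, hb t ω]
  algebraMap_mem' _ _ _ := rfl
  star_mem' ha t ω := by simp [ha t ω]

instance rightInvariant_isClosed : IsClosed (X.rightInvariant : Set C(X.carrier, ℂ)) := by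
  have h : (X.rightInvariant : Set C(X.carrier, ℂ)) =
      ⋂ (t : Γ) (ω : X.carrier), {f | f (X.rightMap t ω) = f ω} := by
    ext f
    simp [rightInvariant]
  rw [h]
  exact isClosed_iInter fun t => isClosed_iInter fun ω =>
    isClosed_eq (continuous_eval_const _) (continuous_eval_const _)

/-- The left action on `C(X)^{Γ_r}`: `(s · f)(ω) = f(s⁻¹ ω)`. -/
def leftTranslate (s : Γ) : X.rightInvariant →⋆ₐ[ℂ] X.rightInvariant where
  toFun f := ⟨f.1.comp (X.leftMap s⁻¹), fun t ω => by
    simp only [ContinuousMap.comp_apply, leftMap_rightMap]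
    exact f.2 t _⟩
  map_one' := rfl
  map_mul' _ _ := rfl
  map_zero' := rfl
  map_add' _ _ := rfl
  commutes' _ := rfl
  map_star' _ := rfl

theorem leftTranslate_one : X.leftTranslate 1 = StarAlgHom.id ℂ X.rightInvariant := by
  ext f ω
  change f.1 (X.leftMap 1⁻¹ ω) = f.1 ω
  rw [inv_one, leftMap_one]

theorem leftTranslate_mul (s t : Γ) :
    X.leftTranslate (s * t) = (X.leftTranslate s).comp (X.leftTranslate t) := by
  ext f ω
  change f.1 (X.leftMap (s * t)⁻¹ ω) = f.1 (X.leftMap t⁻¹ (X.leftMap s⁻¹ ω))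
  rw [mul_inv_rev, leftMap_mul]

/-- The Gelfand spectrum of `C(X)^{Γ_r}`. -/
abbrev Spectrum : Type u := WeakDual.characterSpace ℂ X.rightInvariant

/-- The action of `Γ` on the Gelfand spectrum induced by the left action on `C(X)^{Γ_r}`:
`(s · χ)(f) = χ(s⁻¹ · f)`. -/
instance : MulAction Γ X.Spectrum where
  smul s χ := WeakDual.CharacterSpace.compContinuousMap (X.leftTranslate s⁻¹) χ
  one_smul χ := by
    change WeakDual.CharacterSpace.compContinuousMap (X.leftTranslate 1⁻¹) χ = χ
    rw [inv_one, leftTranslate_one, WeakDual.CharacterSpace.compContinuousMap_id]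
    rfl
  mul_smul s t χ := by
    change WeakDual.CharacterSpace.compContinuousMap (X.leftTranslate (s * t)⁻¹) χ =
      WeakDual.CharacterSpace.compContinuousMap (X.leftTranslate s⁻¹)
        (WeakDual.CharacterSpace.compContinuousMap (X.leftTranslate t⁻¹) χ)
    rw [mul_inv_rev, leftTranslate_mul, WeakDual.CharacterSpace.compContinuousMap_comp]
    rfl

theorem smul_spectrum_apply (s : Γ) (χ : X.Spectrum) (f : X.rightInvariant) :
    (s • χ) f = χ (X.leftTranslate s⁻¹ f) := rfl

instance : ContinuousConstSMul Γ X.Spectrum where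
  continuous_const_smul s :=
    (WeakDual.CharacterSpace.compContinuousMap (X.leftTranslate s⁻¹)).continuous

/-- `Γ` is bi-exact towards `X` if the left action on the Gelfand spectrum of `C(X)^{Γ_r}` is
amenable. -/
def IsBiExact : Prop := IsAmenableAction Γ X.Spectrum

end BoundaryPiece

/-! ### Proximal pieces -/

/-- For an action of `Γ` on a compact space `K` and a measure `η` on `K`, the set `∂_η Γ ⊆ ΔΓ`
of the ultrafilters `ω` such that for every `h ∈ Γ`, `(g h) · η - g · η → 0` in the weak-*
topology as `g → ω`. Here `g · η` is the push-forward of `η` under `x ↦ g x`. -/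
def proximalPiece (Γ : Type u) {K : Type*} [Group Γ] [TopologicalSpace K] [MulAction Γ K]
    [MeasurableSpace K] (η : Measure K) : Set (Ultrafilter Γ) :=
  {ω | ∀ (h : Γ) (f : C(K, ℂ)),
    Tendsto (fun g : Γ => ∫ x, f x ∂(η.map fun x => (g * h) • x) - ∫ x, f x ∂(η.map fun x => g • x))
      (ω : Filter Γ) (𝓝 0)}

end

/-!
The three conditions are compared with a fourth one, `BoundaryPiece.HasBoundaryMaps`: for every
finite set `E ⊆ Γ` and `ε > 0` there is a map `ν : Γ → Prob(Γ)`, with all values supported in one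
finite set, that is `ε`-equivariant for left translations by `E` and satisfies
`‖ν(g t) - ν(g)‖₁ → 0` as `g` tends to `X`, for every `t`.

*Exactness.* Exactness of the reduced C*-algebra is equivalent to property A (`HasPropertyA`), the
existence of `ε`-equivariant maps `q : Γ → Prob(Γ)` with uniformly finite supports.

Given `q`, with values supported in `F`, the reduced C*-algebra is compressed to the span of the
point masses in `F`, and matrices `m` over `F` are sent to `∑ mᵢⱼ Tᵢ* Tⱼ`, where `Tᵢ` multiplies by
`t ↦ √(q_t(i))` and then applies `λ_{i⁻¹}`. The composition multiplies `λ_h` by a function uniformly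
close to `1` (`HasPropertyA.isExactGroup`).

Conversely, let `ψ ∘ φ` approximate a faithful representation `π`. By the Hahn–Banach theorem the
completely positive map `φ` is approximated by sums of maps `x ↦ (⟨vᵢ, x vⱼ⟩)ᵢⱼ` with finitely
supported `vᵢ ∈ ℓ²(Γ)`; this uses that a matrix over a C*-algebra is positive if its quadratic form
is. A factorization of the Choi matrix of `ψ` then turns `⟨π(λ_{hg}) ξ, ψ(φ(λ_h)) π(λ_g) ξ⟩ ≈ 1`
into the near equality of two finitely supported vector fields on `Γ`, whose squared norms are the
values of `q` at `h g` and, translated by `h`, at `g` (`IsExactGroup.hasPropertyA`).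

*From bi-exactness to a single map on an exact group.* An amenable action on a non-empty compact
space gives property A along an orbit. Maps from the spectrum of `C(X)^{Γ_r}` to `Prob(F)` pull back
to `X`, extend to `ΔΓ` by Tietze's theorem, and restrict to maps on `Γ` that are almost equivariant
near `X` (`IsBiExact.exists_eventually_equivariant`). Countability of `Γ` and `X ∩ Γ = ∅` provide a
depth function on `Γ` that tends to infinity at `X` and is almost invariant under translations;
averaging the first approximations up to the depth of `g` gives a single asymptotically equivariant
`μ` (`exists_asymptotically_equivariant`).

*From such a map to boundary maps.* Moving slowly from `μ` near `X` to the exactly equivariant map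
`g ↦ δ_g` away from `X` gives an almost equivariant map on all of `Γ`. Composing it with a map `q`
from property A makes the supports uniformly finite
(`BoundaryPiece.hasBoundaryMaps_of_hasPropertyA`).

*From boundary maps to proximal pieces and back.* Sequences of boundary maps are the points of a
compact space of families of probability measures, on which `Γ` acts amenably by construction. The
chosen boundary maps are a point `x₀` for which `g h x₀` and `g x₀` have the same limits as `g`
tends to `X`, so `X` lies in the proximal piece of the point mass at `x₀`
(`BoundaryPiece.HasBoundaryMaps.exists_amenable_proximal`).
Conversely, if `P : K → Prob(F)` is almost equivariant, then `g ↦ ∫ P(g x) dη(x)` is a boundary map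
(`BoundaryPiece.hasBoundaryMaps_of_subset_proximalPiece`).

*From boundary maps to bi-exactness.* The limits of the coordinates of `ν` at the points of `X` are
functions in `C(X)^{Γ_r}`. Since every character of this algebra is a point evaluation, these
functions define an almost equivariant map from the spectrum to `Prob(Γ)`
(`BoundaryPiece.HasBoundaryMaps.isBiExact`).
-/

noncomputable section

/-! ### The `ℓ¹`-distance and barycentres of probability measures -/

namespace DiscreteProb

variable {Γ : Type*} {I : Type*}

theorem l1Dist_nonneg (p q : DiscreteProb Γ) : 0 ≤ l1Dist p q :=
  tsum_nonneg fun _ => abs_nonneg _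

theorem l1Dist_self (p : DiscreteProb Γ) : l1Dist p p = 0 := by simp [l1Dist]

theorem l1Dist_comm (p q : DiscreteProb Γ) : l1Dist p q = l1Dist q p := by
  simp only [l1Dist, abs_sub_comm]

theorem l1Dist_triangle (p q r : DiscreteProb Γ) : l1Dist p r ≤ l1Dist p q + l1Dist q r := by
  unfold l1Dist
  rw [← (summable_abs_sub p q).tsum_add (summable_abs_sub q r)]
  exact (summable_abs_sub p r).tsum_le_tsum (fun g => abs_sub_le _ _ _)
    ((summable_abs_sub p q).add (summable_abs_sub q r))

theorem l1Dist_le_two (p q : DiscreteProb Γ) : l1Dist p q ≤ 2 := by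
  have h : l1Dist p q ≤ ∑' g, (p.1 g + q.1 g) :=
    (summable_abs_sub p q).tsum_le_tsum
      (fun g => (abs_sub _ _).trans (by rw [abs_of_nonneg (p.2.1 g), abs_of_nonneg (q.2.1 g)]))
      (p.2.2.summable.add q.2.2.summable)
  rw [p.2.2.summable.tsum_add q.2.2.summable, p.2.2.tsum_eq, q.2.2.tsum_eq] at h
  linarith

theorem l1Dist_le_of_forall_sum {p q : DiscreteProb Γ} {ε : ℝ}
    (h : ∀ T : Finset Γ, ∑ a ∈ T, |p.1 a - q.1 a| ≤ ε) : l1Dist p q ≤ ε :=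
  (summable_abs_sub p q).tsum_le_of_sum_le h

theorem sum_abs_sub_le_l1Dist (p q : DiscreteProb Γ) (T : Finset Γ) :
    ∑ a ∈ T, |p.1 a - q.1 a| ≤ l1Dist p q :=
  (summable_abs_sub p q).sum_le_tsum T fun _ _ => abs_nonneg _

theorem l1Dist_eq_sum {p q : DiscreteProb Γ} {T : Finset Γ} (hp : ∀ a ∉ T, p.1 a = 0)
    (hq : ∀ a ∉ T, q.1 a = 0) : l1Dist p q = ∑ a ∈ T, |p.1 a - q.1 a| :=
  tsum_eq_sum fun a ha => by simp [hp a ha, hq a ha]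

theorem sum_le_one (p : DiscreteProb Γ) (T : Finset Γ) : ∑ a ∈ T, p.1 a ≤ 1 :=
  (p.2.2.summable.sum_le_tsum T fun a _ => p.2.1 a).trans_eq p.2.2.tsum_eq

theorem continuous_coe_apply (a : Γ) : Continuous fun p : DiscreteProb Γ => p.1 a :=
  (continuous_apply a).comp continuous_subtype_val

theorem sum_eq_one {p : DiscreteProb Γ} {T : Finset Γ} (hp : ∀ a ∉ T, p.1 a = 0) :
    ∑ a ∈ T, p.1 a = 1 :=
  (hasSum_sum_of_ne_finset_zero hp).unique p.2.2

/-- A probability measure with finite support, given by its density. -/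
def ofFinset (T : Finset Γ) (f : Γ → ℝ) (h0 : ∀ a, 0 ≤ f a) (hT : ∀ a ∉ T, f a = 0)
    (h1 : ∑ a ∈ T, f a = 1) : DiscreteProb Γ :=
  ⟨f, h0, h1 ▸ hasSum_sum_of_ne_finset_zero hT⟩

/-- The point mass at `a`. -/
def pointMass [DecidableEq Γ] (a : Γ) : DiscreteProb Γ :=
  ofFinset {a} (fun b => if b = a then 1 else 0) (fun b => by split_ifs <;> norm_num)
    (fun b hb => by simpa using hb) (by simp)

section translate

variable {G : Type u} [Group G]

theorem translate_apply (s : G) (p : DiscreteProb G) (g : G) :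
    (translate s p).1 g = p.1 (s⁻¹ * g) := rfl

theorem translate_one (p : DiscreteProb G) : translate 1 p = p := by
  ext g
  simp [translate_apply]

theorem l1Dist_translate (s : G) (p q : DiscreteProb G) :
    l1Dist (translate s p) (translate s q) = l1Dist p q :=
  (Equiv.mulLeft s⁻¹).tsum_eq fun g => |p.1 g - q.1 g|

theorem translate_pointMass [DecidableEq G] (s a : G) :
    translate s (pointMass a) = pointMass (s * a) := by
  ext g
  simp [translate_apply, pointMass, ofFinset, inv_mul_eq_iff_eq_mul]

theorem translate_eq_zero {F : Finset G} [DecidableEq G] {p : DiscreteProb G}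
    (hp : ∀ a ∉ F, p.1 a = 0) (s : G) : ∀ a ∉ F.image (s * ·), (translate s p).1 a = 0 := by
  intro a ha
  refine hp _ fun h => ha (Finset.mem_image.2 ⟨_, h, by simp⟩)

end translate

theorem summable_mul (w : DiscreteProb I) (p : I → DiscreteProb Γ) :
    Summable (Function.uncurry fun i a => w.1 i * (p i).1 a) := by
  have h0 : 0 ≤ Function.uncurry fun i a => w.1 i * (p i).1 a :=
    fun x => mul_nonneg (w.2.1 x.1) ((p x.1).2.1 x.2)
  rw [summable_prod_of_nonneg h0]
  refine ⟨fun i => (p i).2.2.summable.mul_left (w.1 i), ?_⟩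
  simpa [Function.uncurry, tsum_mul_left, fun i => (p i).2.2.tsum_eq] using w.2.2.summable

theorem summable_mul_left (w : DiscreteProb I) (p : I → DiscreteProb Γ) (a : Γ) :
    Summable fun i => w.1 i * (p i).1 a :=
  (summable_mul w p).comp_injective (i := fun i => (i, a)) fun _ _ h => (Prod.ext_iff.1 h).1

/-- The barycentre `∑ᵢ wᵢ pᵢ` of a family of probability measures. -/
def bind (w : DiscreteProb I) (p : I → DiscreteProb Γ) : DiscreteProb Γ :=
  ⟨fun a => ∑' i, w.1 i * (p i).1 a,
    fun a => tsum_nonneg fun i => mul_nonneg (w.2.1 i) ((p i).2.1 a), by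
      have hs : Summable fun a => ∑' i, w.1 i * (p i).1 a := by
        have := (summable_mul w p).prod_symm.prod
        simpa [Function.uncurry] using this
      have : ∑' a, ∑' i, w.1 i * (p i).1 a = 1 := by
        rw [(summable_mul w p).tsum_comm]
        simp [tsum_mul_left, fun i => (p i).2.2.tsum_eq, w.2.2.tsum_eq]
      have h := hs.hasSum
      rwa [this] at h⟩

theorem bind_apply (w : DiscreteProb I) (p : I → DiscreteProb Γ) (a : Γ) :
    (bind w p).1 a = ∑' i, w.1 i * (p i).1 a := rfl

theorem bind_eq_zero {w : DiscreteProb I} {p : I → DiscreteProb Γ} {F : Finset Γ}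
    (hp : ∀ i, ∀ a ∉ F, (p i).1 a = 0) : ∀ a ∉ F, (bind w p).1 a = 0 := by
  intro a ha
  simp [bind_apply, hp _ a ha]

/-- Minkowski's inequality for a double series. -/
theorem tsum_abs_tsum_le {u : I → Γ → ℝ} {c : I → ℝ} (hc : Summable c)
    (hu : ∀ i, Summable fun a => |u i a|) (h : ∀ i, ∑' a, |u i a| ≤ c i) :
    ∑' a, |∑' i, u i a| ≤ ∑' i, c i := by
  have hS : Summable (Function.uncurry fun i a => |u i a|) :=
    (summable_prod_of_nonneg fun x => abs_nonneg _).2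
      ⟨hu, hc.of_nonneg_of_le (fun i => tsum_nonneg fun a => abs_nonneg _) h⟩
  have hA : Summable fun a => ∑' i, |u i a| := by
    simpa [Function.uncurry] using hS.prod_symm.prod
  have hi : ∀ a, Summable fun i => |u i a| := fun a =>
    hS.comp_injective (i := fun i => (i, a)) fun _ _ h => (Prod.ext_iff.1 h).1
  have hle : ∀ a, |∑' i, u i a| ≤ ∑' i, |u i a| := fun a => by
    simpa using norm_tsum_le_tsum_norm (f := fun i => u i a) (by simpa using hi a)
  calc ∑' a, |∑' i, u i a| ≤ ∑' a, ∑' i, |u i a| :=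
        (hA.of_nonneg_of_le (fun a => abs_nonneg _) hle).tsum_le_tsum hle hA
    _ = ∑' i, ∑' a, |u i a| := hS.tsum_comm
    _ ≤ ∑' i, c i := (hS.prod).tsum_le_tsum h hc

theorem l1Dist_bind_left_le (w w' : DiscreteProb I) (p : I → DiscreteProb Γ) :
    l1Dist (bind w p) (bind w' p) ≤ l1Dist w w' := by
  have h : ∀ a, (bind w p).1 a - (bind w' p).1 a = ∑' i, (w.1 i - w'.1 i) * (p i).1 a := by
    intro a
    rw [bind_apply, bind_apply, ← (summable_mul_left w p a).tsum_sub (summable_mul_left w' p a)]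
    simp only [sub_mul]
  have e : ∀ i, (fun a => |(w.1 i - w'.1 i) * (p i).1 a|)
      = fun a => |w.1 i - w'.1 i| * (p i).1 a := fun i => by
    ext a
    rw [abs_mul, abs_of_nonneg ((p i).2.1 a)]
  unfold l1Dist
  simp only [h]
  refine tsum_abs_tsum_le (summable_abs_sub w w') (fun i => ?_) fun i => ?_
  · rw [e]
    exact (p i).2.2.summable.mul_left _
  · rw [e, tsum_mul_left, (p i).2.2.tsum_eq, mul_one]

theorem l1Dist_bind_right_le (w : DiscreteProb I) (p q : I → DiscreteProb Γ) :
    l1Dist (bind w p) (bind w q) ≤ ∑' i, w.1 i * l1Dist (p i) (q i) := by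
  have h : ∀ a, (bind w p).1 a - (bind w q).1 a = ∑' i, w.1 i * ((p i).1 a - (q i).1 a) := by
    intro a
    rw [bind_apply, bind_apply, ← (summable_mul_left w p a).tsum_sub (summable_mul_left w q a)]
    simp only [mul_sub]
  have e : ∀ i, (fun a => |w.1 i * ((p i).1 a - (q i).1 a)|)
      = fun a => w.1 i * |(p i).1 a - (q i).1 a| := fun i => by
    ext a
    rw [abs_mul, abs_of_nonneg (w.2.1 i)]
  conv_lhs => unfold l1Dist
  simp only [h]
  refine tsum_abs_tsum_le ?_ (fun i => ?_) fun i => ?_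
  · exact (w.2.2.summable.mul_right 2).of_nonneg_of_le
      (fun i => mul_nonneg (w.2.1 i) (l1Dist_nonneg _ _))
      fun i => mul_le_mul_of_nonneg_left (l1Dist_le_two _ _) (w.2.1 i)
  · rw [e]
    exact (summable_abs_sub _ _).mul_left _
  · rw [e, tsum_mul_left]
    rfl

theorem l1Dist_bind_right_le_of_forall {w : DiscreteProb I} {p q : I → DiscreteProb Γ} {ε : ℝ}
    (h : ∀ i, l1Dist (p i) (q i) ≤ ε) : l1Dist (bind w p) (bind w q) ≤ ε := by
  refine (l1Dist_bind_right_le w p q).trans ?_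
  have : HasSum (fun i => w.1 i * ε) ε := by simpa using w.2.2.mul_right ε
  rw [← this.tsum_eq]
  exact (this.summable.of_nonneg_of_le (fun i => mul_nonneg (w.2.1 i) (l1Dist_nonneg _ _))
    fun i => mul_le_mul_of_nonneg_left (h i) (w.2.1 i)).tsum_le_tsum
    (fun i => mul_le_mul_of_nonneg_left (h i) (w.2.1 i)) this.summable

theorem translate_bind {G : Type u} [Group G] (s : G) (w : DiscreteProb I)
    (p : I → DiscreteProb G) : translate s (bind w p) = bind w fun i => translate s (p i) := rfl

theorem bind_translate {G : Type u} [Group G] (s : G) (w : DiscreteProb G)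
    (p : G → DiscreteProb Γ) : bind (translate s w) p = bind w fun g => p (s * g) := by
  ext a
  simp only [bind_apply, translate_apply]
  rw [← (Equiv.mulLeft s).tsum_eq]
  simp

/-- Pointwise convergence implies convergence in `ℓ¹` for measures with a common finite
support. -/
theorem tendsto_l1Dist {ι : Type*} {l : Filter ι} {p q : ι → DiscreteProb Γ} {F : Finset Γ}
    (hp : ∀ i, ∀ a ∉ F, (p i).1 a = 0) (hq : ∀ i, ∀ a ∉ F, (q i).1 a = 0)
    (h : ∀ a ∈ F, Tendsto (fun i => (p i).1 a - (q i).1 a) l (𝓝 0)) :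
    Tendsto (fun i => l1Dist (p i) (q i)) l (𝓝 0) := by
  have : (fun i => l1Dist (p i) (q i)) = fun i => ∑ a ∈ F, |(p i).1 a - (q i).1 a| := by
    ext i
    exact l1Dist_eq_sum (hp i) (hq i)
  rw [this]
  simpa using tendsto_finsetSum F fun a ha => (h a ha).abs

end DiscreteProb

/-! ### Property A and amenable actions -/

open DiscreteProb

/-- Property A of a discrete group, in the form of amenability of the left translation action on
the Stone–Čech compactification: there are almost equivariant maps `q : Γ → Prob(Γ)` all of whose
values are supported in a common finite set. Such a `q` extends continuously to `ΔΓ`. -/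
def HasPropertyA (Γ : Type u) [Group Γ] : Prop :=
  ∀ (E : Finset Γ) (ε : ℝ), 0 < ε → ∃ (F : Finset Γ) (q : Γ → DiscreteProb Γ),
    (∀ g, ∀ a ∉ F, (q g).1 a = 0) ∧
      ∀ h ∈ E, ∀ g, l1Dist (q (h * g)) (translate h (q g)) ≤ ε

namespace DiscreteProb

/-- A continuous family of probability measures on a compact space is uniformly tight. -/
theorem exists_finset_forall_lt_sum {Γ : Type*} {K : Type*} [TopologicalSpace K] [CompactSpace K]
    {P : K → DiscreteProb Γ} (hP : Continuous P) {ε : ℝ} (hε : 0 < ε) :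
    ∃ F : Finset Γ, ∀ x, 1 - ε < ∑ a ∈ F, (P x).1 a := by
  classical
  have hc : ∀ T : Finset Γ, Continuous fun x => ∑ a ∈ T, (P x).1 a := fun T =>
    continuous_finsetSum _ fun a _ => (continuous_coe_apply a).comp hP
  obtain ⟨t, ht⟩ := isCompact_univ.elim_finite_subcover
    (fun T : Finset Γ => {x | 1 - ε < ∑ a ∈ T, (P x).1 a})
    (fun T => isOpen_lt continuous_const (hc T)) (fun x _ => by
      have := (P x).2.2.eventually (lt_mem_nhds (show 1 - ε < 1 by linarith))
      obtain ⟨T, hT⟩ := this.exists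
      exact Set.mem_iUnion.2 ⟨T, hT⟩)
  refine ⟨t.biUnion id, fun x => ?_⟩
  obtain ⟨T, hT, hx⟩ := Set.mem_iUnion₂.1 (ht (Set.mem_univ x))
  exact lt_of_lt_of_le hx (Finset.sum_le_sum_of_subset_of_nonneg
    (Finset.subset_biUnion_of_mem id hT) fun a _ _ => (P x).2.1 a)

variable {Γ : Type*} [DecidableEq Γ]

/-- Moving all the mass outside the finite set `F` to the point `a₀`. -/
def truncate (F : Finset Γ) {a₀ : Γ} (ha₀ : a₀ ∈ F) (p : DiscreteProb Γ) : DiscreteProb Γ :=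
  ofFinset F
    (fun a => if a ∈ F then p.1 a + (if a = a₀ then 1 - ∑ b ∈ F, p.1 b else 0) else 0)
    (fun a => by
      have h := sum_le_one p F
      have := p.2.1 a
      split_ifs <;> linarith)
    (fun a ha => if_neg ha)
    (by
      rw [Finset.sum_congr rfl fun a ha => if_pos ha, Finset.sum_add_distrib,
        Finset.sum_ite_eq' F a₀, if_pos ha₀]
      ring)

theorem truncate_apply {F : Finset Γ} {a₀ : Γ} (ha₀ : a₀ ∈ F) (p : DiscreteProb Γ) (a : Γ) :
    (truncate F ha₀ p).1 a =
      if a ∈ F then p.1 a + (if a = a₀ then 1 - ∑ b ∈ F, p.1 b else 0) else 0 := rfl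

theorem truncate_eq_zero {F : Finset Γ} {a₀ : Γ} (ha₀ : a₀ ∈ F) (p : DiscreteProb Γ) :
    ∀ a ∉ F, (truncate F ha₀ p).1 a = 0 := fun _ ha => if_neg ha

theorem l1Dist_truncate_le {F : Finset Γ} {a₀ : Γ} (ha₀ : a₀ ∈ F) (p : DiscreteProb Γ) :
    l1Dist p (truncate F ha₀ p) ≤ 2 * (1 - ∑ b ∈ F, p.1 b) := by
  have hF := sum_le_one p F
  -- `|p - truncate p|` is at most `p` off `F` plus the moved mass at `a₀`
  have h1 : HasSum (fun a => if a ∈ F then 0 else p.1 a) (1 - ∑ b ∈ F, p.1 b) := by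
    have h := p.2.2.sub (hasSum_sum_of_ne_finset_zero (s := F)
      (f := fun a => if a ∈ F then p.1 a else 0) fun b hb => if_neg hb)
    rw [Finset.sum_congr rfl fun a ha => if_pos ha] at h
    have e : (fun a => if a ∈ F then 0 else p.1 a) =
        fun a => p.1 a - if a ∈ F then p.1 a else 0 := by
      ext a
      split_ifs <;> simp
    rwa [e]
  have h2 : HasSum (fun a => if a = a₀ then 1 - ∑ b ∈ F, p.1 b else 0)
      (1 - ∑ b ∈ F, p.1 b) := hasSum_ite_eq a₀ _
  have h3 := h1.add h2
  rw [two_mul, ← h3.tsum_eq]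
  refine (summable_abs_sub _ _).tsum_le_tsum (fun a => ?_) h3.summable
  rw [truncate_apply]
  by_cases ha : a ∈ F
  · rw [if_pos ha, if_pos ha, sub_add_cancel_left, abs_neg, zero_add, abs_of_nonneg]
    split_ifs <;> linarith
  · have : a ≠ a₀ := fun h => ha (h ▸ ha₀)
    simp [ha, this, abs_of_nonneg (p.2.1 a)]

theorem continuous_truncate {F : Finset Γ} {a₀ : Γ} (ha₀ : a₀ ∈ F) :
    Continuous (truncate F ha₀) := by
  refine Continuous.subtype_mk (continuous_pi fun a => ?_) _
  split_ifs
  · exact (continuous_coe_apply a).add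
      (continuous_const.sub (continuous_finsetSum _ fun b _ => continuous_coe_apply b))
  · exact (continuous_coe_apply a).add continuous_const
  · exact continuous_const

end DiscreteProb

section amenable

variable {Γ : Type u} [Group Γ] {K : Type*} [TopologicalSpace K] [CompactSpace K] [MulAction Γ K]
  [ContinuousConstSMul Γ K]

/-- Amenability of an action on a compact space is witnessed by maps with values in the
probability measures on a fixed finite set. -/
theorem IsAmenableAction.exists_finite_support (hK : IsAmenableAction Γ K) (E : Finset Γ) {ε : ℝ}
    (hε : 0 < ε) : ∃ (F : Finset Γ) (P : K → DiscreteProb Γ), Continuous P ∧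
      (∀ x, ∀ a ∉ F, (P x).1 a = 0) ∧
      ∀ g ∈ E, ∀ x, l1Dist (P (g • x)) (translate g (P x)) ≤ ε := by
  classical
  obtain ⟨P, hP, hPE⟩ := hK E (ε / 2) (by positivity)
  obtain ⟨F, hF⟩ := exists_finset_forall_lt_sum hP (show 0 < ε / 8 by positivity)
  have h1 : (1 : Γ) ∈ insert 1 F := Finset.mem_insert_self _ _
  have hd : ∀ x, l1Dist (P x) (truncate _ h1 (P x)) ≤ ε / 4 := fun x => by
    refine (l1Dist_truncate_le h1 (P x)).trans ?_
    have := Finset.sum_le_sum_of_subset_of_nonneg (Finset.subset_insert 1 F)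
      fun a _ _ => (P x).2.1 a
    linarith [hF x]
  refine ⟨insert 1 F, fun x => truncate _ h1 (P x), (continuous_truncate h1).comp hP,
    fun x => truncate_eq_zero h1 _, fun g hg x => ?_⟩
  have := l1Dist_triangle (truncate _ h1 (P (g • x))) (P (g • x))
    (translate g (truncate _ h1 (P x)))
  have h2 := l1Dist_triangle (P (g • x)) (translate g (P x)) (translate g (truncate _ h1 (P x)))
  rw [l1Dist_translate] at h2
  change l1Dist (truncate _ h1 (P (g • x))) (translate g (truncate _ h1 (P x))) ≤ ε
  linarith [hd x, hd (g • x), hPE g hg x, l1Dist_comm (P (g • x)) (truncate _ h1 (P (g • x)))]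

/-- The orbit map of a point pulls an amenable action back to the group itself. -/
theorem IsAmenableAction.hasPropertyA [Nonempty K] (hK : IsAmenableAction Γ K) :
    HasPropertyA Γ := by
  intro E ε hε
  obtain ⟨F, P, -, hF, hE⟩ := hK.exists_finite_support E hε
  obtain ⟨x⟩ := ‹Nonempty K›
  exact ⟨F, fun g => P (g • x), fun g => hF _, fun h hh g => by
    simp only [mul_smul]
    exact hE h hh _⟩

end amenable

/-! ### Positivity in matrix algebras over a represented C*-algebra -/

section cstar

variable {B : Type*} [NonUnitalCStarAlgebra B] [PartialOrder B] [StarOrderedRing B]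

theorem nonneg_iff_exists_star_mul_self {a : B} : 0 ≤ a ↔ ∃ b, a = star b * b :=
  CStarAlgebra.nonneg_iff_eq_star_mul_self

/-- If no nonzero `-T*T` is of the form `N*MN`, then the negative part `N` of the self-adjoint
element `M` vanishes: `N*MN = -N³ = -T*T` with `T = N^{3/2}`. -/
theorem nonneg_of_forall_star_mul_self_eq_neg {M : B} (hM : IsSelfAdjoint M)
    (h : ∀ N T : B, star N * (M * N) = -(star T * T) → T = 0) : 0 ≤ M := by
  set N : B := M⁻ with hN
  have hN0 : 0 ≤ N := CFC.negPart_nonneg M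
  have hNs : star N = N := (IsSelfAdjoint.of_nonneg hN0).star_eq
  obtain ⟨R, hR⟩ := nonneg_iff_exists_star_mul_self.1 hN0
  have hMN : M * N = -(N * N) := by
    conv_lhs => rw [← CFC.posPart_sub_negPart M hM]
    rw [sub_mul, ← hN, hN, CFC.posPart_mul_negPart, zero_sub]
  have hT : star (R * N) * (R * N) = N * N * N := by
    rw [star_mul, hNs, mul_assoc, ← mul_assoc (star R), ← hR, mul_assoc]
  have hT0 : R * N = 0 := h N _ (by rw [hT, hMN, hNs, mul_neg, mul_assoc])
  rw [hT0, mul_zero] at hT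
  have hNN : N * N = 0 := by
    refine (CStarRing.star_mul_self_eq_zero_iff _).1 ?_
    rw [star_mul, hNs, ← mul_assoc, ← hT, zero_mul]
  have hN0 : N = 0 := by
    refine (CStarRing.star_mul_self_eq_zero_iff _).1 ?_
    rw [hNs, hNN]
  exact (CFC.negPart_eq_zero_iff M hM).1 hN0

end cstar

section matrixForm

variable {A : Type*} [CStarAlgebra A]
  {H : Type*} [NormedAddCommGroup H] [InnerProductSpace ℂ H] [CompleteSpace H]
  {n : Type*} [Fintype n]

/-- The action of a matrix over `A` on the direct sum of copies of `H`, for a representation `ρ`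
of `A` on `H`. -/
def matrixAct (ρ : A →⋆ₐ[ℂ] (H →L[ℂ] H)) (M : CStarMatrix n n A) (v : n → H) : n → H :=
  fun i => ∑ j, ρ (M i j) (v j)

/-- The sesquilinear form on the direct sum of copies of `H` given by a matrix over `A`. -/
def matrixForm (ρ : A →⋆ₐ[ℂ] (H →L[ℂ] H)) (M : CStarMatrix n n A) (v w : n → H) : ℂ :=
  ∑ i, ∑ j, inner ℂ (v i) (ρ (M i j) (w j))

variable (ρ : A →⋆ₐ[ℂ] (H →L[ℂ] H))

theorem matrixForm_eq (M : CStarMatrix n n A) (v w : n → H) :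
    matrixForm ρ M v w = ∑ i, inner ℂ (v i) (matrixAct ρ M w i) := by
  simp [matrixForm, matrixAct]

theorem matrixAct_mul (M N : CStarMatrix n n A) (v : n → H) :
    matrixAct ρ (M * N) v = matrixAct ρ M (matrixAct ρ N v) := by
  ext i
  simp only [matrixAct, CStarMatrix.mul_apply, map_sum, map_mul, sum_apply,
    mul_apply_eq_comp]
  exact Finset.sum_comm

theorem matrixForm_star (M : CStarMatrix n n A) (v w : n → H) :
    matrixForm ρ (star M) v w = star (matrixForm ρ M w v) := by
  simp only [matrixForm, star_sum]
  rw [Finset.sum_comm]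
  refine Finset.sum_congr rfl fun i _ => Finset.sum_congr rfl fun j _ => ?_
  rw [CStarMatrix.star_apply, map_star, ContinuousLinearMap.star_eq_adjoint,
    ContinuousLinearMap.adjoint_inner_right]
  exact (inner_conj_symm _ _).symm

theorem matrixForm_star_mul (M N : CStarMatrix n n A) (v w : n → H) :
    matrixForm ρ (star M * N) v w = ∑ i, inner ℂ (matrixAct ρ M v i) (matrixAct ρ N w i) := by
  rw [matrixForm_eq, matrixAct_mul, ← matrixForm_eq, matrixForm_star, matrixForm_eq, star_sum]
  exact Finset.sum_congr rfl fun i _ => inner_conj_symm _ _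

theorem matrixForm_add (M N : CStarMatrix n n A) (v w : n → H) :
    matrixForm ρ (M + N) v w = matrixForm ρ M v w + matrixForm ρ N v w := by
  simp [matrixForm, Finset.sum_add_distrib]

theorem matrixForm_neg (M : CStarMatrix n n A) (v w : n → H) :
    matrixForm ρ (-M) v w = -matrixForm ρ M v w := by
  simp [matrixForm]

theorem eq_zero_of_matrixAct_eq_zero (hρ : Function.Injective ρ) {M : CStarMatrix n n A}
    (h : ∀ v, matrixAct ρ M v = 0) : M = 0 := by
  classical
  ext i j
  refine hρ (ContinuousLinearMap.ext fun x => ?_)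
  have := congrFun (h (Pi.single j x)) i
  rw [matrixAct, Finset.sum_eq_single j (fun l _ hl => by simp [Pi.single_eq_of_ne hl])
    (by simp)] at this
  simpa using this

/-- A self-adjoint matrix over a faithfully represented C*-algebra whose associated quadratic form
is nonnegative is positive. -/
theorem CStarMatrix.nonneg_of_matrixForm_nonneg [PartialOrder A] [StarOrderedRing A]
    (hρ : Function.Injective ρ) {M : CStarMatrix n n A} (hM : IsSelfAdjoint M)
    (h : ∀ v, 0 ≤ (matrixForm ρ M v v).re) : 0 ≤ M := by
  refine nonneg_of_forall_star_mul_self_eq_neg hM fun N T hNT => ?_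
  refine eq_zero_of_matrixAct_eq_zero ρ hρ fun v => ?_
  have h1 := h (matrixAct ρ N v)
  rw [matrixForm_eq, ← matrixAct_mul, ← matrixForm_star_mul, hNT, matrixForm_neg,
    matrixForm_star_mul, Complex.neg_re, Complex.re_sum] at h1
  have h2 : ∀ i, (inner ℂ (matrixAct ρ T v i) (matrixAct ρ T v i)).re =
      ‖matrixAct ρ T v i‖ ^ 2 := fun i => by
    rw [inner_self_eq_norm_sq_to_K]
    norm_cast
  simp only [h2] at h1
  have h3 : ∑ i, ‖matrixAct ρ T v i‖ ^ 2 = 0 :=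
    le_antisymm (by linarith) (Finset.sum_nonneg fun i _ => by positivity)
  ext i
  have := (Finset.sum_eq_zero_iff_of_nonneg fun i _ => by positivity).1 h3 i (Finset.mem_univ i)
  simpa using this

theorem CStarMatrix.re_sum_entries_nonneg {m : Type*} [Fintype m]
    {M : CStarMatrix m m (CStarMatrix m m ℂ)} (hM : 0 ≤ M) : 0 ≤ (∑ i, ∑ j, M i j i j).re := by
  obtain ⟨N, rfl⟩ := nonneg_iff_exists_star_mul_self.1 hM
  have : ∑ i, ∑ j, (star N * N) i j i j =
      ∑ l, ∑ h, star (∑ i, N l i h i) * ∑ i, N l i h i := by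
    simp only [CStarMatrix.mul_apply, CStarMatrix.star_apply, star_sum, Finset.sum_mul_sum]
    have e : ∀ i j, (∑ l, star (N l i) * N l j) i j
        = ∑ l, ∑ h, star (N l i h i) * N l j h j := fun i j => by
      have : ∀ s : Finset m, (∑ l ∈ s, star (N l i) * N l j) i j
          = ∑ l ∈ s, (star (N l i) * N l j) i j := fun s => by
        classical
        induction s using Finset.induction_on with
        | empty => rfl
        | insert a s ha ih =>
          rw [Finset.sum_insert ha, Finset.sum_insert ha, CStarMatrix.add_apply, ih]
      rw [this]
      simp [CStarMatrix.mul_apply, CStarMatrix.star_apply]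
    simp only [e]
    calc ∑ i, ∑ j, ∑ l, ∑ h, star (N l i h i) * N l j h j
        = ∑ i, ∑ l, ∑ h, ∑ j, star (N l i h i) * N l j h j := by
          refine Finset.sum_congr rfl fun i _ => ?_
          rw [Finset.sum_comm]
          refine Finset.sum_congr rfl fun l _ => Finset.sum_comm
      _ = ∑ l, ∑ h, ∑ i, ∑ j, star (N l i h i) * N l j h j := by
          rw [Finset.sum_comm]
          refine Finset.sum_congr rfl fun l _ => Finset.sum_comm
  rw [this, Complex.re_sum]
  refine Finset.sum_nonneg fun l _ => ?_
  rw [Complex.re_sum]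
  refine Finset.sum_nonneg fun h _ => ?_
  rw [Complex.star_def, ← Complex.normSq_eq_conj_mul_self]
  exact_mod_cast Complex.normSq_nonneg _

end matrixForm

/-! ### Approximation of completely positive maps into matrices by vector functionals -/

section approx

variable {A : Type*} [CStarAlgebra A] {H : Type*} [NormedAddCommGroup H] [InnerProductSpace ℂ H]
  [CompleteSpace H] (ρ : A →⋆ₐ[ℂ] (H →L[ℂ] H))

/-- The family of matrices `⟨v i, ρ (a s) v j⟩` attached to the vectors `v i`. -/
def vectorMatrices {S n : Type*} (a : S → A) (v : n → H) : S → n → n → ℂ :=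
  fun s i j => inner ℂ (v i) (ρ (a s) (v j))

theorem vectorMatrices_smul {S n : Type*} (a : S → A) (v : n → H) (c : ℝ) :
    vectorMatrices ρ a (fun i => (c : ℂ) • v i) = (c * c) • vectorMatrices ρ a v := by
  ext s i j
  simp [vectorMatrices, mul_assoc]

/-- A real-linear functional on a finite-dimensional complex coordinate space is the real part of
a complex-linear one. -/
theorem exists_re_sum_eq {S n : Type*} [Fintype S] [Fintype n] (f : (S → n → n → ℂ) →ₗ[ℝ] ℝ) :
    ∃ c : S → n → n → ℂ, ∀ x, f x = (∑ s, ∑ i, ∑ j, c s i j * x s i j).re := by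
  classical
  let e : S → n → n → ℂ → (S → n → n → ℂ) := fun s i j z =>
    Pi.single s (Pi.single i (Pi.single j z))
  have hx : ∀ x : S → n → n → ℂ, x = ∑ s, ∑ i, ∑ j,
      ((x s i j).re • e s i j 1 + (x s i j).im • e s i j Complex.I) := by
    intro x
    have h : ∀ s i j, (x s i j).re • e s i j 1 + (x s i j).im • e s i j Complex.I
        = e s i j (x s i j) := fun s i j => by
      simp only [e, ← Pi.single_smul, ← Pi.single_add]
      congr 3
      simp [Complex.re_add_im]
    simp only [h]
    ext s i j
    simp only [Finset.sum_apply, e]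
    rw [Finset.sum_eq_single s (fun t _ ht => by simp [Pi.single_eq_of_ne' ht]) (by simp),
      Finset.sum_eq_single i (fun t _ ht => by simp [Pi.single_eq_of_ne' ht]) (by simp),
      Finset.sum_eq_single j (fun t _ ht => by simp [Pi.single_eq_of_ne' ht]) (by simp)]
    simp
  refine ⟨fun s i j => f (e s i j 1) - f (e s i j Complex.I) * Complex.I, fun x => ?_⟩
  conv_lhs => rw [hx x]
  simp only [map_sum, map_add, map_smul, Complex.re_sum]
  refine Finset.sum_congr rfl fun s _ => Finset.sum_congr rfl fun i _ =>
    Finset.sum_congr rfl fun j _ => ?_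
  simp
  ring

variable [PartialOrder A] [StarOrderedRing A]

/-- If a real functional of the matrices `⟨v i, ρ (a s) v j⟩` is nonnegative on the vectors from a
dense subspace, it is nonnegative on the values of every completely positive map: it is the
quadratic form of a positive matrix over `A`. -/
theorem CompletelyPositiveMap.re_sum_nonneg (hρ : Function.Injective ρ) {k : ℕ}
    (φ : A →CP CStarMatrix (Fin k) (Fin k) ℂ) {D : Submodule ℂ H} (hD : Dense (D : Set H))
    {S : Type*} [Fintype S] (a : S → A) (c : S → Fin k → Fin k → ℂ)
    (h : ∀ v : Fin k → H, (∀ i, v i ∈ D) →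
      0 ≤ (∑ s, ∑ i, ∑ j, c s i j * vectorMatrices ρ a v s i j).re) :
    0 ≤ (∑ s, ∑ i, ∑ j, c s i j * φ (a s) i j).re := by
  let b : CStarMatrix (Fin k) (Fin k) A := CStarMatrix.ofMatrix fun i j => ∑ s, c s i j • a s
  have hb : ∀ i j, b i j = ∑ s, c s i j • a s := fun _ _ => rfl
  have hform : ∀ v, matrixForm ρ b v v = ∑ s, ∑ i, ∑ j, c s i j * vectorMatrices ρ a v s i j := by
    intro v
    simp only [matrixForm, hb, vectorMatrices, map_sum, map_smul, sum_apply,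
      smul_apply, inner_sum, inner_smul_right]
    rw [Finset.sum_congr rfl fun i _ => Finset.sum_comm, Finset.sum_comm]
  have hpos : ∀ v, 0 ≤ (matrixForm ρ b v v).re := by
    have hc : Continuous fun v : Fin k → H => (matrixForm ρ b v v).re := by
      unfold matrixForm
      fun_prop
    have hd : Dense {v : Fin k → H | ∀ i, v i ∈ D} := by
      have := dense_pi Set.univ fun (i : Fin k) _ => hD
      simpa [Set.pi] using this
    intro v
    exact (isClosed_le continuous_const hc).closure_subset_iff.2
      (fun w hw => by
        change 0 ≤ (matrixForm ρ b w w).re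
        rw [hform]
        exact h w hw) (hd v)
  have hM : 0 ≤ b + star b := by
    refine CStarMatrix.nonneg_of_matrixForm_nonneg ρ hρ (IsSelfAdjoint.add_star_self b) fun v => ?_
    rw [matrixForm_add, matrixForm_star, Complex.add_re, Complex.star_def, Complex.conj_re]
    linarith [hpos v]
  have h1 := CStarMatrix.re_sum_entries_nonneg (φ.map_cstarMatrix_nonneg _ hM)
  have h2 : ∑ i, ∑ j, φ (b i j) i j = ∑ s, ∑ i, ∑ j, c s i j * φ (a s) i j := by
    have e : ∀ i j, φ (b i j) i j = ∑ s, c s i j * φ (a s) i j := fun i j => by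
      let ev : CStarMatrix (Fin k) (Fin k) ℂ →ₗ[ℂ] ℂ :=
        { toFun := fun m => m i j, map_add' := fun _ _ => rfl, map_smul' := fun _ _ => rfl }
      change ev (φ (b i j)) = ∑ s, c s i j * ev (φ (a s))
      simp [hb]
    simp only [e]
    rw [Finset.sum_congr rfl fun i _ => Finset.sum_comm, Finset.sum_comm]
  have h3 : ∑ i, ∑ j, ((b + star b).map φ) i j i j =
      ∑ i, ∑ j, φ (b i j) i j + star (∑ i, ∑ j, φ (b i j) i j) := by
    have e : ∀ i j, ((b + star b).map φ) i j i j = φ (b i j) i j + star (φ (b j i) j i) := by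
      intro i j
      rw [CStarMatrix.map_apply, CStarMatrix.add_apply, CStarMatrix.star_apply, map_add, map_star,
        CStarMatrix.add_apply, CStarMatrix.star_apply]
    simp only [e, Finset.sum_add_distrib, star_sum]
    congr 1
    exact Finset.sum_comm
  rw [h3, Complex.add_re, Complex.star_def, Complex.conj_re, h2] at h1
  linarith

/-- A completely positive map into matrices is a point-norm limit of sums of maps
`x ↦ (⟨v i, ρ x v j⟩)ᵢⱼ` with vectors from a dense subspace, by the Hahn–Banach theorem. -/
theorem CompletelyPositiveMap.exists_vectorMatrices_approx (hρ : Function.Injective ρ) {k : ℕ}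
    (φ : A →CP CStarMatrix (Fin k) (Fin k) ℂ) {D : Submodule ℂ H} (hD : Dense (D : Set H))
    {S : Type*} [Fintype S] (a : S → A) {δ : ℝ} (hδ : 0 < δ) :
    ∃ (l : ℕ) (v : Fin l → Fin k → H), (∀ m i, v m i ∈ D) ∧
      ∀ s i j, ‖∑ m, vectorMatrices ρ a (v m) s i j - φ (a s) i j‖ < δ := by
  let R : Set (S → Fin k → Fin k → ℂ) :=
    {x | ∃ v : Fin k → H, (∀ i, v i ∈ D) ∧ x = vectorMatrices ρ a v}
  let y : S → Fin k → Fin k → ℂ := fun s i j => φ (a s) i j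
  have hy : y ∈ closure (convexHull ℝ R) := by
    by_contra hy
    obtain ⟨f, u, hf, hu⟩ := geometric_hahn_banach_closed_point
      (convex_convexHull ℝ R).closure isClosed_closure hy
    have hfR : ∀ x ∈ R, f x < u := fun x hx => hf x (subset_closure (subset_convexHull ℝ R hx))
    have h0 : 0 < u := by
      have := hfR 0 ⟨0, fun i => D.zero_mem, by ext; simp [vectorMatrices]⟩
      simpa using this
    -- `R` is a cone, so a functional bounded above on it is nonpositive there
    have hneg : ∀ x ∈ R, f x ≤ 0 := by
      rintro x ⟨v, hv, rfl⟩
      by_contra! hx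
      set X := f (vectorMatrices ρ a v)
      have := hfR _ ⟨fun i => ((Real.sqrt (u / X) : ℝ) : ℂ) • v i,
        fun i => D.smul_mem _ (hv i), rfl⟩
      rw [vectorMatrices_smul, Real.mul_self_sqrt (by positivity), map_smul, smul_eq_mul,
        div_mul_cancel₀ _ hx.ne'] at this
      exact lt_irrefl _ this
    obtain ⟨c, hc⟩ := exists_re_sum_eq (f : (S → Fin k → Fin k → ℂ) →ₗ[ℝ] ℝ)
    have hc' : ∀ x, f x = (∑ s, ∑ i, ∑ j, c s i j * x s i j).re := hc
    have := CompletelyPositiveMap.re_sum_nonneg ρ hρ φ hD a (fun s i j => -c s i j) fun v hv => by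
      have := hneg _ ⟨v, hv, rfl⟩
      rw [hc'] at this
      simpa using this
    have hfy := hc' y
    simp only [neg_mul, Finset.sum_neg_distrib, Complex.neg_re] at this
    simp only [y] at hfy hu
    linarith
  obtain ⟨x, hx, hxy⟩ := Metric.mem_closure_iff.1 hy δ hδ
  obtain ⟨ι, _, w, z, hw, -, hz, rfl⟩ := mem_convexHull_iff_exists_fintype.1 hx
  choose v hv hvz using hz
  let e := Fintype.equivFin ι
  refine ⟨Fintype.card ι, fun m i => ((Real.sqrt (w (e.symm m)) : ℝ) : ℂ) • v (e.symm m) i,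
    fun m i => D.smul_mem _ (hv _ i), fun s i j => ?_⟩
  have h1 : ∑ m, vectorMatrices ρ a
      (fun i => ((Real.sqrt (w (e.symm m)) : ℝ) : ℂ) • v (e.symm m) i) s i j
        = (∑ m, w m • z m) s i j := by
    simp only [vectorMatrices_smul, Real.mul_self_sqrt (hw _), ← hvz]
    rw [e.symm.sum_comp fun m => (w m • z m) s i j]
    simp only [Finset.sum_apply]
  rw [h1, ← dist_eq_norm, dist_comm]
  exact ((dist_le_pi_dist (y s i) _ j).trans ((dist_le_pi_dist (y s) _ i).trans
    (dist_le_pi_dist y _ s))).trans_lt hxy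

end approx

/-! ### The left regular representation -/

section regular

variable {Γ : Type u}

variable (Γ) in
/-- The finitely supported vectors in `ℓ²(Γ)`. -/
def finitelySupported : Submodule ℂ (EllTwo Γ) where
  carrier := {v | ∃ T : Finset Γ, ∀ f ∉ T, v f = 0}
  zero_mem' := ⟨∅, fun _ _ => rfl⟩
  add_mem' := by
    classical
    rintro v w ⟨T, hT⟩ ⟨S, hS⟩
    refine ⟨T ∪ S, fun f hf => ?_⟩
    rw [Finset.mem_union, not_or] at hf
    simp [hT f hf.1, hS f hf.2]
  smul_mem' := by
    rintro c v ⟨T, hT⟩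
    exact ⟨T, fun f hf => by simp [hT f hf]⟩

theorem dense_finitelySupported : Dense (finitelySupported Γ : Set (EllTwo Γ)) := by
  classical
  intro v
  refine mem_closure_of_tendsto (lp.hasSum_single (by norm_num) v)
    (Eventually.of_forall fun T => ?_)
  refine (finitelySupported Γ).sum_mem fun g _ => ⟨{g}, fun f hf => ?_⟩
  rw [Finset.mem_singleton] at hf
  simp [lp.single_apply, hf]

variable [Group Γ]

theorem leftRegular_one : leftRegular (1 : Γ) = 1 := by
  ext ξ g
  simp [leftRegular_apply]

theorem leftRegular_mul (s t : Γ) : leftRegular (s * t) = leftRegular s * leftRegular t := by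
  ext ξ g
  change ξ ((s * t)⁻¹ * g) = ξ (t⁻¹ * (s⁻¹ * g))
  rw [mul_inv_rev, mul_assoc]

theorem norm_leftRegular_apply (s : Γ) (ξ : EllTwo Γ) : ‖leftRegular s ξ‖ = ‖ξ‖ := by
  unfold leftRegular
  rw [LinearIsometry.coe_toContinuousLinearMap, LinearIsometry.norm_map]

theorem star_leftRegular (s : Γ) : star (leftRegular s) = leftRegular s⁻¹ := by
  have h : star (leftRegular s) * leftRegular s = 1 :=
    (ContinuousLinearMap.norm_map_iff_adjoint_comp_self _).1 (norm_leftRegular_apply s)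
  have h' : leftRegular s * leftRegular s⁻¹ = 1 := by
    rw [← leftRegular_mul, mul_inv_cancel, leftRegular_one]
  exact left_inv_eq_right_inv h h'

variable (Γ) in
theorem leftRegular_mem (s : Γ) : leftRegular s ∈ reducedCStar Γ :=
  StarSubalgebra.le_topologicalClosure _ (StarAlgebra.subset_adjoin ℂ _ ⟨s, rfl⟩)

/-- The unitary `λ_s` as an element of the reduced C*-algebra. -/
def regularUnitary (s : Γ) : reducedCStar Γ := ⟨leftRegular s, leftRegular_mem Γ s⟩

theorem regularUnitary_one : regularUnitary (1 : Γ) = 1 := Subtype.ext leftRegular_one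

theorem regularUnitary_mul (s t : Γ) :
    regularUnitary (s * t) = regularUnitary s * regularUnitary t :=
  Subtype.ext (leftRegular_mul s t)

theorem star_regularUnitary (s : Γ) : star (regularUnitary s) = regularUnitary s⁻¹ :=
  Subtype.ext (star_leftRegular s)

theorem inner_leftRegular_eq_sum {v w : EllTwo Γ} {T : Finset Γ} (hv : ∀ f ∉ T, v f = 0) (h : Γ) :
    inner ℂ v (leftRegular h w) = ∑ f ∈ T, star (v f) * w (h⁻¹ * f) := by
  rw [lp.inner_eq_tsum, tsum_eq_sum (s := T) fun f hf => by simp [hv f hf]]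
  refine Finset.sum_congr rfl fun f _ => ?_
  rw [leftRegular_apply, RCLike.inner_apply, mul_comm]
  rfl

end regular

/-! ### Exactness implies property A -/

/-- A completely positive map from a matrix algebra into operators is given by a Choi matrix,
which is positive. -/
theorem CompletelyPositiveMap.exists_choi {k : ℕ} {H : Type*} [NormedAddCommGroup H]
    [InnerProductSpace ℂ H] [CompleteSpace H]
    (ψ : CStarMatrix (Fin k) (Fin k) ℂ →CP (H →L[ℂ] H)) :
    ∃ B : Fin k → Fin k → (H →L[ℂ] H), ∀ m : CStarMatrix (Fin k) (Fin k) ℂ,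
      ψ m = ∑ i, ∑ j, m i j • ∑ l, star (B l i) * B l j := by
  let e : Fin k → Fin k → CStarMatrix (Fin k) (Fin k) ℂ := fun i j =>
    CStarMatrix.ofMatrix (Matrix.single i j 1)
  have he : ∀ i l j, star (e l i) * e l j = e i j := fun i l j => by
    ext a b
    simp only [e, CStarMatrix.mul_apply, CStarMatrix.star_apply, CStarMatrix.ofMatrix_apply,
      Matrix.single_apply]
    by_cases ha : i = a <;> by_cases hb : j = b <;> simp [ha, hb]
  let c : ℂ := ((Real.sqrt k)⁻¹ : ℝ)
  let E : CStarMatrix (Fin k) (Fin k) (CStarMatrix (Fin k) (Fin k) ℂ) := CStarMatrix.ofMatrix e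
  let R : CStarMatrix (Fin k) (Fin k) (CStarMatrix (Fin k) (Fin k) ℂ) :=
    CStarMatrix.ofMatrix fun i j => c • e i j
  have hE : 0 ≤ E := by
    refine nonneg_iff_exists_star_mul_self.2 ⟨R, ?_⟩
    refine CStarMatrix.ext fun i j => ?_
    have hk : (k : ℝ) ≠ 0 := by
      have := i.pos
      positivity
    have hc : (k : ℂ) * (star c * c) = 1 := by
      have : (k : ℝ) * ((Real.sqrt k)⁻¹ * (Real.sqrt k)⁻¹) = 1 := by
        rw [← mul_inv, Real.mul_self_sqrt (by positivity), mul_inv_cancel₀ hk]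
      simp only [c, Complex.star_def, Complex.conj_ofReal]
      exact_mod_cast this
    rw [CStarMatrix.mul_apply]
    have : ∀ l, star R i l * R l j = (star c * c) • e i j := fun l => by
      change star (c • e l i) * (c • e l j) = _
      rw [star_smul, smul_mul_smul_comm, he]
    rw [Finset.sum_congr rfl fun l _ => this l, Finset.sum_const, Finset.card_univ,
      Fintype.card_fin, ← Nat.cast_smul_eq_nsmul ℂ, smul_smul, hc, one_smul]
    rfl
  obtain ⟨B, hB⟩ := nonneg_iff_exists_star_mul_self.1 (ψ.map_cstarMatrix_nonneg _ hE)
  refine ⟨fun i j => B i j, fun m => ?_⟩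
  have hm : m = ∑ i, ∑ j, m i j • e i j := by
    have h := Matrix.matrix_eq_sum_single (CStarMatrix.ofMatrix.symm m)
    have h2 : ∀ i j, m i j • e i j
        = (Matrix.single i j (m i j) : Matrix (Fin k) (Fin k) ℂ) := fun i j => by
      change m i j • (Matrix.single i j (1 : ℂ)) = _
      rw [Matrix.smul_single, smul_eq_mul, mul_one]
    simp only [h2]
    exact h
  have hψ : ∀ i j, ψ (e i j) = ∑ l, star (B l i) * B l j := fun i j => by
    have := congrFun (congrFun hB i) j
    rw [CStarMatrix.map_apply, CStarMatrix.mul_apply] at this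
    exact this
  conv_lhs => rw [hm]
  simp only [map_sum, map_smul, hψ]

/-- Almost equal families of vectors with almost unit `ℓ²`-norm give almost equal probability
densities. -/
theorem sum_abs_normalized_sub_le {Γ V : Type*} [NormedAddCommGroup V] [InnerProductSpace ℂ V]
    (T : Finset Γ) (a b : Γ → V) {δ ε : ℝ} (hε : 0 ≤ ε) (h2 : δ ≤ 1 / 2)
    (h4 : 4 * δ ≤ ε) (h100 : 96 * δ ≤ ε ^ 2) {Na Nb : ℝ} (hNa : ∑ f ∈ T, ‖a f‖ ^ 2 = Na)
    (hNb : ∑ f ∈ T, ‖b f‖ ^ 2 = Nb) (ha : |Na - 1| ≤ δ) (hb : |Nb - 1| ≤ δ)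
    (hab : 1 - δ ≤ (∑ f ∈ T, inner ℂ (a f) (b f)).re) :
    ∑ f ∈ T, |‖a f‖ ^ 2 / Na - ‖b f‖ ^ 2 / Nb| ≤ ε := by
  have ha' := abs_le.1 ha
  have hb' := abs_le.1 hb
  have hNa0 : 0 < Na := by linarith
  have hNb0 : 0 < Nb := by linarith
  have hdiff : ∑ f ∈ T, ‖a f - b f‖ ^ 2 ≤ 4 * δ := by
    have : ∀ f, ‖a f - b f‖ ^ 2 = ‖a f‖ ^ 2 + ‖b f‖ ^ 2 - 2 * (inner ℂ (a f) (b f)).re :=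
      fun f => by
        have := norm_sub_sq (𝕜 := ℂ) (a f) (b f)
        simp only [RCLike.re_to_complex] at this
        linarith
    simp only [this, Finset.sum_sub_distrib, Finset.sum_add_distrib, ← Finset.mul_sum]
    rw [hNa, hNb, ← Complex.re_sum]
    linarith
  have hsum : ∑ f ∈ T, (‖a f‖ + ‖b f‖) ^ 2 ≤ 6 := by
    have : ∑ f ∈ T, (‖a f‖ + ‖b f‖) ^ 2 ≤ ∑ f ∈ T, (2 * ‖a f‖ ^ 2 + 2 * ‖b f‖ ^ 2) :=
      Finset.sum_le_sum fun f _ => by nlinarith [sq_nonneg (‖a f‖ - ‖b f‖)]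
    rw [Finset.sum_add_distrib, ← Finset.mul_sum, ← Finset.mul_sum, hNa, hNb] at this
    linarith
  have hCS : ∑ f ∈ T, |‖a f‖ ^ 2 - ‖b f‖ ^ 2| ≤ ε / 2 := by
    have h1 : ∑ f ∈ T, |‖a f‖ ^ 2 - ‖b f‖ ^ 2| ≤
        ∑ f ∈ T, ‖a f - b f‖ * (‖a f‖ + ‖b f‖) := by
      refine Finset.sum_le_sum fun f _ => ?_
      rw [sq_sub_sq, abs_mul, abs_of_nonneg (by positivity : 0 ≤ ‖a f‖ + ‖b f‖), mul_comm]
      exact mul_le_mul_of_nonneg_right (abs_norm_sub_norm_le _ _) (by positivity)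
    refine h1.trans (abs_le_of_sq_le_sq' ?_ (by positivity)).2
    calc _ ≤ (∑ f ∈ T, ‖a f - b f‖ ^ 2) * ∑ f ∈ T, (‖a f‖ + ‖b f‖) ^ 2 :=
          Finset.sum_mul_sq_le_sq_mul_sq _ _ _
      _ ≤ (4 * δ) * 6 := mul_le_mul hdiff hsum (Finset.sum_nonneg fun f _ => by positivity)
          ((Finset.sum_nonneg fun f _ => by positivity).trans hdiff)
      _ ≤ (ε / 2) ^ 2 := by linarith
  have hnorm : ∀ (c : Γ → V) (N : ℝ), 0 < N → ∑ f ∈ T, ‖c f‖ ^ 2 = N → |N - 1| ≤ δ →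
      ∑ f ∈ T, |‖c f‖ ^ 2 / N - ‖c f‖ ^ 2| ≤ δ := fun c N hN0 hN h => by
    have : ∀ f, |‖c f‖ ^ 2 / N - ‖c f‖ ^ 2| = ‖c f‖ ^ 2 * (|N - 1| / N) := fun f => by
      rw [show ‖c f‖ ^ 2 / N - ‖c f‖ ^ 2 = ‖c f‖ ^ 2 * ((1 - N) / N) by field_simp, abs_mul,
        abs_of_nonneg (by positivity : 0 ≤ ‖c f‖ ^ 2), abs_div, abs_of_pos hN0, abs_sub_comm]
    simp only [this, ← Finset.sum_mul, hN]
    rwa [mul_div_cancel₀ _ hN0.ne']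
  calc _ ≤ ∑ f ∈ T, (|‖a f‖ ^ 2 / Na - ‖a f‖ ^ 2| + |‖a f‖ ^ 2 - ‖b f‖ ^ 2| +
        |‖b f‖ ^ 2 / Nb - ‖b f‖ ^ 2|) := Finset.sum_le_sum fun f _ => by
          rw [abs_sub_comm (‖b f‖ ^ 2 / Nb)]
          exact (abs_sub_le _ (‖b f‖ ^ 2) _).trans (add_le_add_left (abs_sub_le _ _ _) _)
    _ ≤ δ + ε / 2 + δ := by
          rw [Finset.sum_add_distrib, Finset.sum_add_distrib]
          exact add_le_add (add_le_add (hnorm a Na hNa0 hNa ha) hCS) (hnorm b Nb hNb0 hNb hb)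
    _ ≤ ε := by linarith

section exactGroup

variable {Γ : Type u} [Group Γ]

/-- The matrix `Y(h) = (∑ₘ ⟨vₘᵢ, λ_h vₘⱼ⟩)ᵢⱼ` of coefficients of the left regular representation. -/
def coefficientMatrix {k l : ℕ} (v : Fin l → Fin k → EllTwo Γ) (h : Γ) :
    CStarMatrix (Fin k) (Fin k) ℂ :=
  CStarMatrix.ofMatrix fun i j => ∑ m, inner ℂ (v m i) (leftRegular h (v m j))

/-- The finitely supported vector field on `Γ` built from the vectors `v` and the factors `B` of a
Choi matrix. Together with `inner_choiField` this is an explicit Kolmogorov decomposition of the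
kernel `⟨ξ, ψ(Y(h)) ζ⟩`. -/
def choiField {k l : ℕ} {H : Type*} [NormedAddCommGroup H] [InnerProductSpace ℂ H]
    (v : Fin l → Fin k → EllTwo Γ) (B : Fin k → Fin k → (H →L[ℂ] H)) (ξ : H) (f : Γ) :
    PiLp 2 fun _ : Fin k × Fin l => H :=
  WithLp.toLp 2 fun p => ∑ i, v p.2 i f • B p.1 i ξ

theorem inner_choiField {k l : ℕ} {H : Type*} [NormedAddCommGroup H] [InnerProductSpace ℂ H]
    [CompleteSpace H] {v : Fin l → Fin k → EllTwo Γ} {B : Fin k → Fin k → (H →L[ℂ] H)}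
    {T : Finset Γ} (hT : ∀ m i, ∀ f ∉ T, v m i f = 0)
    {ψ : CStarMatrix (Fin k) (Fin k) ℂ → (H →L[ℂ] H)}
    (hψ : ∀ m, ψ m = ∑ i, ∑ j, m i j • ∑ l, star (B l i) * B l j) (ξ ζ : H) (h : Γ) :
    ∑ f ∈ T, inner ℂ (choiField v B ξ f) (choiField v B ζ (h⁻¹ * f)) =
      inner ℂ ξ (ψ (coefficientMatrix v h) ζ) := by
  have hL : ∀ f, inner ℂ (choiField v B ξ f) (choiField v B ζ (h⁻¹ * f)) =
      ∑ i, ∑ j, ∑ m, ∑ n, (star (v m i f) * v m j (h⁻¹ * f)) *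
        inner ℂ (B n i ξ) (B n j ζ) := by
    intro f
    rw [PiLp.inner_apply, Fintype.sum_prod_type]
    simp only [choiField, sum_inner, inner_sum, inner_smul_left, inner_smul_right,
      Finset.mul_sum]
    calc _ = ∑ n, ∑ i, ∑ m, ∑ j, (star (v m i f) * v m j (h⁻¹ * f)) *
          inner ℂ (B n i ξ) (B n j ζ) := by
          refine Finset.sum_congr rfl fun n _ => ?_
          rw [Finset.sum_congr rfl fun m _ => Finset.sum_comm, Finset.sum_comm]
          refine Finset.sum_congr rfl fun i _ => Finset.sum_congr rfl fun m _ =>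
            Finset.sum_congr rfl fun j _ => ?_
          rw [Complex.star_def]
          ring
      _ = ∑ i, ∑ n, ∑ j, ∑ m, (star (v m i f) * v m j (h⁻¹ * f)) *
          inner ℂ (B n i ξ) (B n j ζ) := by
          rw [Finset.sum_comm]
          exact Finset.sum_congr rfl fun i _ => Finset.sum_congr rfl fun n _ => Finset.sum_comm
      _ = _ := by
          refine Finset.sum_congr rfl fun i _ => ?_
          rw [Finset.sum_comm]
          exact Finset.sum_congr rfl fun j _ => Finset.sum_comm
  have hR : ∀ i j, coefficientMatrix v h i j =
      ∑ m, ∑ f ∈ T, star (v m i f) * v m j (h⁻¹ * f) := fun i j => by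
    change ∑ m, inner ℂ (v m i) (leftRegular h (v m j)) = _
    exact Finset.sum_congr rfl fun m _ => inner_leftRegular_eq_sum (hT m i) h
  have hB : ∀ i j, inner ℂ ξ ((∑ n, star (B n i) * B n j) ζ) =
      ∑ n, inner ℂ (B n i ξ) (B n j ζ) := fun i j => by
    rw [sum_apply, inner_sum]
    refine Finset.sum_congr rfl fun n _ => ?_
    rw [mul_apply_eq_comp, ContinuousLinearMap.star_eq_adjoint,
      ContinuousLinearMap.adjoint_inner_right]
  rw [hψ]
  simp only [hL, sum_apply, inner_sum, smul_apply, inner_smul_right]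
  rw [Finset.sum_comm]
  refine Finset.sum_congr rfl fun i _ => ?_
  rw [Finset.sum_comm]
  refine Finset.sum_congr rfl fun j _ => ?_
  have := hB i j
  simp only [sum_apply, inner_sum] at this
  rw [this, hR]
  simp only [← Finset.mul_sum, ← Finset.sum_mul]
  rw [Finset.sum_comm]

/-- Exactness of the reduced C*-algebra implies property A. The nuclear approximation `ψ ∘ φ` of a
faithful representation `π` is perturbed so that `φ(λ_h)` becomes a matrix of coefficients of
finitely supported vectors; the squared norms of the resulting vector fields, evaluated at the unit
vectors `π(λ_g) ξ`, are the almost equivariant probability measures. -/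
theorem IsExactGroup.hasPropertyA (hΓ : IsExactGroup Γ) : HasPropertyA Γ := by
  classical
  let _ : PartialOrder (reducedCStar Γ) := CStarAlgebra.spectralOrder (reducedCStar Γ)
  let _ : StarOrderedRing (reducedCStar Γ) := CStarAlgebra.spectralOrderedRing (reducedCStar Γ)
  obtain ⟨H, _, _, _, π, hπ, hnuc⟩ := hΓ
  have hone : (1 : reducedCStar Γ) ≠ 0 := by
    intro h
    have h1 : (1 : EllTwo Γ →L[ℂ] EllTwo Γ) = 0 := congrArg Subtype.val h
    have h2 := congrArg (fun T : EllTwo Γ →L[ℂ] EllTwo Γ => T (lp.single 2 (1 : Γ) (1 : ℂ)) 1) h1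
    simp [lp.single_apply] at h2
  obtain ⟨ξ, hξ⟩ : ∃ ξ : H, ‖ξ‖ = 1 := by
    have : Nontrivial H := by
      by_contra hH
      rw [not_nontrivial_iff_subsingleton] at hH
      exact hone (hπ (ContinuousLinearMap.ext fun x => Subsingleton.elim _ _))
    exact exists_norm_eq H zero_le_one
  let Ξ : Γ → H := fun g => π (regularUnitary g) ξ
  have hΞ : ∀ h g, π (regularUnitary h) (Ξ g) = Ξ (h * g) := fun h g => by
    simp only [Ξ, regularUnitary_mul, map_mul, mul_apply_eq_comp]
  have hΞ1 : ∀ g, ‖Ξ g‖ = 1 := fun g => by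
    have h : star (π (regularUnitary g)) * π (regularUnitary g) = 1 := by
      rw [← map_star, ← map_mul, star_regularUnitary, ← regularUnitary_mul, inv_mul_cancel,
        regularUnitary_one, map_one]
    rw [(ContinuousLinearMap.norm_map_iff_adjoint_comp_self _).2 h, hξ]
  intro E ε hε
  -- the choice of `δ` is dictated by `sum_abs_normalized_sub_le`
  let δ : ℝ := min (min (1 / 2) (ε / 4)) (ε ^ 2 / 96)
  have hδ : 0 < δ := by positivity
  obtain ⟨k, φ, ψ, -, -, hφψ⟩ := hnuc ((insert 1 E).image regularUnitary) (δ / 2) (by positivity)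
  obtain ⟨B, hB⟩ := ψ.exists_choi
  let C : ℝ := ∑ i, ∑ j, ‖∑ l, star (B l i) * B l j‖
  have hC : 0 ≤ C := Finset.sum_nonneg fun i _ => Finset.sum_nonneg fun j _ => norm_nonneg _
  obtain ⟨l, v, hv, happ⟩ := φ.exists_vectorMatrices_approx (reducedCStar Γ).subtype
    Subtype.val_injective dense_finitelySupported
    (fun s : (insert 1 E : Finset Γ) => regularUnitary s.1)
    (show 0 < δ / (2 * (C + 1)) by positivity)
  choose S hS using hv
  let F : Finset Γ := Finset.univ.biUnion fun m => Finset.univ.biUnion fun i => S m i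
  have hF : ∀ m i, ∀ f ∉ F, v m i f = 0 := fun m i f hf => hS m i f fun h => hf <|
    Finset.mem_biUnion.2 ⟨m, Finset.mem_univ _, Finset.mem_biUnion.2 ⟨i, Finset.mem_univ _, h⟩⟩
  have hψ : ∀ s ∈ insert 1 E, ‖ψ (coefficientMatrix v s) - π (regularUnitary s)‖ ≤ δ := by
    intro s hs
    have h1 : ‖ψ (coefficientMatrix v s) - ψ (φ (regularUnitary s))‖ ≤ δ / 2 := by
      rw [← map_sub, hB]
      calc _ ≤ ∑ i, ∑ j, ‖(coefficientMatrix v s - φ (regularUnitary s)) i j •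
            ∑ l, star (B l i) * B l j‖ :=
            (norm_sum_le _ _).trans (Finset.sum_le_sum fun i _ => norm_sum_le _ _)
        _ ≤ ∑ i, ∑ j, δ / (2 * (C + 1)) * ‖∑ l, star (B l i) * B l j‖ := by
            refine Finset.sum_le_sum fun i _ => Finset.sum_le_sum fun j _ => ?_
            rw [norm_smul]
            exact mul_le_mul_of_nonneg_right (happ ⟨s, hs⟩ i j).le (norm_nonneg _)
        _ = δ / (2 * (C + 1)) * C := by simp only [C, Finset.mul_sum]
        _ ≤ δ / 2 := by
            rw [div_mul_eq_mul_div, div_le_div_iff₀ (by positivity) (by positivity)]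
            nlinarith
    have h2 := hφψ _ (Finset.mem_image_of_mem _ hs)
    calc _ ≤ _ := norm_sub_le_norm_sub_add_norm_sub _ (ψ (φ (regularUnitary s))) _
      _ ≤ δ := by linarith
  have hinner : ∀ s ∈ insert 1 E, ∀ g,
      ‖inner ℂ (Ξ (s * g)) (ψ (coefficientMatrix v s) (Ξ g)) - 1‖ ≤ δ := by
    intro s hs g
    have h1 : (1 : ℂ) = inner ℂ (Ξ (s * g)) (π (regularUnitary s) (Ξ g)) := by
      rw [hΞ, inner_self_eq_norm_sq_to_K, hΞ1]
      simp
    rw [h1, ← inner_sub_right, ← sub_apply]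
    calc _ ≤ ‖Ξ (s * g)‖ * (‖ψ (coefficientMatrix v s) - π (regularUnitary s)‖ * ‖Ξ g‖) :=
          (norm_inner_le_norm _ _).trans
            (mul_le_mul_of_nonneg_left (ContinuousLinearMap.le_opNorm _ _) (norm_nonneg _))
      _ ≤ δ := by simpa [hΞ1] using hψ s hs
  let κ : Γ → Γ → PiLp 2 fun _ : Fin k × Fin l => H := fun g f => choiField v B (Ξ g) f
  have hκ0 : ∀ g, ∀ f ∉ F, κ g f = 0 := fun g f hf => by
    ext p
    simp [κ, choiField, hF _ _ f hf]
  let N : Γ → ℝ := fun g => ∑ f ∈ F, ‖κ g f‖ ^ 2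
  have hN : ∀ g, |N g - 1| ≤ δ := fun g => by
    have h1 := inner_choiField hF hB (Ξ g) (Ξ g) 1
    have h2 := hinner 1 (Finset.mem_insert_self _ _) g
    rw [one_mul, ← h1] at h2
    have h3 : ∑ f ∈ F, inner ℂ (choiField v B (Ξ g) f) (choiField v B (Ξ g) (1⁻¹ * f)) =
        (N g : ℂ) := by
      simp only [inv_one, one_mul, inner_self_eq_norm_sq_to_K, N, κ]
      push_cast
      rfl
    rw [h3] at h2
    rw [← Real.norm_eq_abs, ← Complex.norm_real]
    simpa using h2
  have hN0 : ∀ g, 0 < N g := fun g => by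
    have := (abs_le.1 (hN g)).1
    have : δ ≤ 1 / 2 := (min_le_left _ _).trans (min_le_left _ _)
    linarith
  refine ⟨F, fun g => ofFinset F (fun f => ‖κ g f‖ ^ 2 / N g)
    (fun f => div_nonneg (by positivity) (hN0 g).le) (fun f hf => by simp [hκ0 g f hf])
    (by rw [← Finset.sum_div]; exact div_self (hN0 g).ne'), fun g f hf => ?_, fun h hh g => ?_⟩
  · change ‖κ g f‖ ^ 2 / N g = 0
    simp [hκ0 g f hf]
  · let T := F ∪ F.image (h * ·)
    have hT1 : ∀ f ∉ T, κ (h * g) f = 0 := fun f hf => hκ0 _ f fun h' => hf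
      (Finset.mem_union_left _ h')
    have hT2 : ∀ f ∉ T, κ g (h⁻¹ * f) = 0 := fun f hf => hκ0 _ _ fun h' => hf
      (Finset.mem_union_right _ (Finset.mem_image.2 ⟨_, h', by simp⟩))
    rw [l1Dist_eq_sum (T := T)
      (fun f hf => show ‖κ (h * g) f‖ ^ 2 / N (h * g) = 0 by simp [hT1 f hf])
      (fun f hf => show ‖κ g (h⁻¹ * f)‖ ^ 2 / N g = 0 by simp [hT2 f hf])]
    refine sum_abs_normalized_sub_le T (κ (h * g)) (fun f => κ g (h⁻¹ * f)) (δ := δ) hε.le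
      ((min_le_left _ _).trans (min_le_left _ _)) ?_ ?_ ?_ ?_ (hN _) (hN _) ?_
    · have : δ ≤ ε / 4 := (min_le_left _ _).trans (min_le_right _ _)
      linarith
    · have : δ ≤ ε ^ 2 / 96 := min_le_right _ _
      linarith
    · exact (Finset.sum_subset Finset.subset_union_left fun f _ hf => by simp [hκ0 _ f hf]).symm
    · have h1 : ∑ f ∈ F.image (h * ·), ‖κ g (h⁻¹ * f)‖ ^ 2 = N g := by
        rw [Finset.sum_image fun a _ b _ hab => mul_left_cancel hab]
        simp [N]
      rw [← h1]
      refine (Finset.sum_subset Finset.subset_union_right fun f _ hf => ?_).symm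
      rw [hκ0 g (h⁻¹ * f) fun h' => hf (Finset.mem_image.2 ⟨_, h', by simp⟩)]
      simp
    · have h1 := inner_choiField (T := T)
        (fun m i f hf => hF m i f fun h' => hf (Finset.mem_union_left _ h')) hB (Ξ (h * g)) (Ξ g) h
      rw [h1]
      have h2 := (Complex.abs_re_le_norm _).trans (hinner h (Finset.mem_insert_of_mem hh) g)
      rw [Complex.sub_re, Complex.one_re] at h2
      linarith [(abs_le.1 h2).1]

end exactGroup

/-! ### Completely positive maps from dilations -/

section dilation

variable {A B H V : Type*} [CStarAlgebra A] [PartialOrder A] [StarOrderedRing A]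
  [CStarAlgebra B] [PartialOrder B] [StarOrderedRing B]
  [NormedAddCommGroup H] [InnerProductSpace ℂ H] [CompleteSpace H]
  [NormedAddCommGroup V] [InnerProductSpace ℂ V]

/-- A linear map with a Stinespring-type dilation `⟨w, θ(a*b) w'⟩ = ⟨S a w, S b w'⟩` is completely
positive, and it is contractive if it is unital. -/
theorem exists_completelyPositiveMap_of_dilation (θ : A →ₗ[ℂ] B) (σ : B →⋆ₐ[ℂ] (H →L[ℂ] H))
    (hσ : Function.Injective σ) (S : A → H → V)
    (hS : ∀ a b w w', inner ℂ w (σ (θ (star a * b)) w') = inner ℂ (S a w) (S b w'))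
    (h1 : θ 1 = 1) : ∃ Θ : A →CP B, (∀ a, Θ a = θ a) ∧ ∀ a, ‖Θ a‖ ≤ ‖a‖ := by
  have hstar : ∀ a b, θ (star a * b) = star (θ (star b * a)) := fun a b => by
    refine hσ (ContinuousLinearMap.ext fun w' => ext_inner_left ℂ fun w => ?_)
    rw [map_star, ContinuousLinearMap.star_eq_adjoint, ContinuousLinearMap.adjoint_inner_right,
      hS, ← inner_conj_symm (σ (θ (star b * a)) w) w', hS, inner_conj_symm]
  let Θ : A →CP B :=
    { θ with
      map_cstarMatrix_nonneg' := fun k M hM => by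
        obtain ⟨N, rfl⟩ := nonneg_iff_exists_star_mul_self.1 hM
        have hN : ∀ i j, (star N * N).map θ i j = ∑ l, θ (star (N l i) * N l j) := fun i j => by
          rw [CStarMatrix.map_apply, CStarMatrix.mul_apply, map_sum]
          simp only [CStarMatrix.star_apply]
        change 0 ≤ (star N * N).map θ
        refine CStarMatrix.nonneg_of_matrixForm_nonneg σ hσ ?_ fun v => ?_
        · refine CStarMatrix.ext fun i j => ?_
          rw [CStarMatrix.star_apply, hN, hN, star_sum]
          exact Finset.sum_congr rfl fun l _ => (hstar _ _).symm
        · have : matrixForm σ ((star N * N).map θ) v v =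
              ∑ l, inner ℂ (∑ i, S (N l i) (v i)) (∑ i, S (N l i) (v i)) := by
            simp only [matrixForm, hN, map_sum, sum_apply, inner_sum, sum_inner, hS]
            calc _ = ∑ i, ∑ l, ∑ j, inner ℂ (S (N l i) (v i)) (S (N l j) (v j)) :=
                  Finset.sum_congr rfl fun i _ => Finset.sum_comm
              _ = ∑ l, ∑ i, ∑ j, inner ℂ (S (N l i) (v i)) (S (N l j) (v j)) := Finset.sum_comm
              _ = _ := Finset.sum_congr rfl fun l _ => Finset.sum_comm
          rw [this, Complex.re_sum]
          exact Finset.sum_nonneg fun l _ => inner_self_nonneg (𝕜 := ℂ) }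
  have hΘ : ∀ a, Θ a = θ a := fun _ => rfl
  refine ⟨Θ, hΘ, fun a => ?_⟩
  have hB : ‖Θ 1‖ ≤ 1 := by
    rw [hΘ, h1]
    have := CStarRing.norm_star_mul_self (x := (1 : B))
    rw [star_one, one_mul] at this
    nlinarith [norm_nonneg (1 : B)]
  have hpos : ‖Θ (star a * a)‖ ≤ ‖a‖ ^ 2 := by
    have h := PositiveLinearMap.norm_apply_le_of_nonneg (PositiveLinearMap.ofClass Θ) (star a * a)
      (star_mul_self_nonneg a)
    calc _ ≤ ‖Θ 1‖ * ‖star a * a‖ := h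
      _ ≤ 1 * ‖star a * a‖ := mul_le_mul_of_nonneg_right hB (norm_nonneg _)
      _ = ‖a‖ ^ 2 := by rw [one_mul, CStarRing.norm_star_mul_self, sq]
  have hSa : ∀ b, ‖θ (star b * b)‖ ≤ ‖b‖ ^ 2 → ∀ w, ‖S b w‖ ≤ ‖b‖ * ‖w‖ := fun b hb w => by
    refine abs_le_of_sq_le_sq' ?_ (by positivity) |>.2
    have h2 : ((‖S b w‖ ^ 2 : ℝ) : ℂ) = inner ℂ w (σ (θ (star b * b)) w) := by
      rw [hS, inner_self_eq_norm_sq_to_K]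
      norm_cast
    have h3 : ‖S b w‖ ^ 2 ≤ ‖w‖ * (‖θ (star b * b)‖ * ‖w‖) := by
      calc ‖S b w‖ ^ 2 = ‖((‖S b w‖ ^ 2 : ℝ) : ℂ)‖ := by
            rw [Complex.norm_real, Real.norm_of_nonneg (by positivity)]
        _ ≤ ‖w‖ * ‖σ (θ (star b * b)) w‖ := by rw [h2]; exact norm_inner_le_norm _ _
        _ ≤ _ := by
            refine mul_le_mul_of_nonneg_left ?_ (norm_nonneg _)
            refine (ContinuousLinearMap.le_opNorm _ _).trans ?_
            rw [NonUnitalStarAlgHom.norm_map σ hσ]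
    nlinarith [mul_le_mul_of_nonneg_left hb (sq_nonneg ‖w‖)]
  have hS1 : ∀ w, ‖S 1 w‖ ≤ ‖w‖ := fun w => by
    have h2 : ((‖S 1 w‖ ^ 2 : ℝ) : ℂ) = ((‖w‖ ^ 2 : ℝ) : ℂ) := by
      have := hS 1 1 w w
      rw [star_one, one_mul, h1, map_one, one_apply_eq_self,
        inner_self_eq_norm_sq_to_K, inner_self_eq_norm_sq_to_K] at this
      exact_mod_cast this.symm
    have h3 : ‖S 1 w‖ ^ 2 = ‖w‖ ^ 2 := Complex.ofReal_injective h2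
    exact (abs_le_of_sq_le_sq' h3.le (norm_nonneg _)).2
  rw [hΘ, ← NonUnitalStarAlgHom.norm_map σ hσ]
  refine ContinuousLinearMap.opNorm_le_of_re_inner_le (norm_nonneg _) fun w' w hw' hw => ?_
  have h4 := hS 1 a w w'
  rw [star_one, one_mul] at h4
  rw [inner_re_symm, h4]
  calc RCLike.re (inner ℂ (S 1 w) (S a w')) ≤ ‖S 1 w‖ * ‖S a w'‖ := re_inner_le_norm _ _
    _ ≤ ‖w‖ * (‖a‖ * ‖w'‖) := mul_le_mul (hS1 w) (hSa a hpos w') (norm_nonneg _) (norm_nonneg _)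
    _ = ‖a‖ := by rw [hw, hw']; ring

end dilation

section compression

/-- The action of matrices on `ℂᵏ`. -/
def cstarMatrixRep (k : ℕ) : CStarMatrix (Fin k) (Fin k) ℂ →⋆ₐ[ℂ]
    (EuclideanSpace ℂ (Fin k) →L[ℂ] EuclideanSpace ℂ (Fin k)) :=
  ((CStarMatrix.ofMatrixStarAlgEquiv (n := Fin k) (A := ℂ)).symm.trans
    (Matrix.toEuclideanCLM (n := Fin k) (𝕜 := ℂ)) :
      CStarMatrix (Fin k) (Fin k) ℂ ≃⋆ₐ[ℂ] _)

theorem cstarMatrixRep_injective (k : ℕ) : Function.Injective (cstarMatrixRep k) :=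
  ((CStarMatrix.ofMatrixStarAlgEquiv (n := Fin k) (A := ℂ)).symm.trans
    (Matrix.toEuclideanCLM (n := Fin k) (𝕜 := ℂ))).injective

theorem inner_cstarMatrixRep {k : ℕ} (m : CStarMatrix (Fin k) (Fin k) ℂ)
    (w w' : EuclideanSpace ℂ (Fin k)) :
    inner ℂ w (cstarMatrixRep k m w') = ∑ i, ∑ j, star (w i) * m i j * w' j := by
  have h : ∀ i, (cstarMatrixRep k m w') i = ∑ j, m i j * w' j := fun i => rfl
  simp only [PiLp.inner_apply, h, RCLike.inner_apply, Finset.sum_mul]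
  refine Finset.sum_congr rfl fun i _ => Finset.sum_congr rfl fun j _ => ?_
  rw [Complex.star_def]
  ring

variable {A H : Type*} [CStarAlgebra A] [PartialOrder A] [StarOrderedRing A]
  [NormedAddCommGroup H] [InnerProductSpace ℂ H] [CompleteSpace H]

/-- Compression to the span of an orthonormal family is completely positive and contractive. -/
theorem exists_compression (ρ : A →⋆ₐ[ℂ] (H →L[ℂ] H)) {k : ℕ} {v : Fin k → H}
    (hv : Orthonormal ℂ v) : ∃ Θ : A →CP CStarMatrix (Fin k) (Fin k) ℂ,
      (∀ a i j, Θ a i j = inner ℂ (v i) (ρ a (v j))) ∧ ∀ a, ‖Θ a‖ ≤ ‖a‖ := by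
  let θ : A →ₗ[ℂ] CStarMatrix (Fin k) (Fin k) ℂ :=
    { toFun := fun a => CStarMatrix.ofMatrix fun i j => inner ℂ (v i) (ρ a (v j))
      map_add' := fun a b => CStarMatrix.ext fun i j => by
        change inner ℂ (v i) (ρ (a + b) (v j)) =
          inner ℂ (v i) (ρ a (v j)) + inner ℂ (v i) (ρ b (v j))
        rw [map_add, add_apply, inner_add_right]
      map_smul' := fun c a => CStarMatrix.ext fun i j => by
        change inner ℂ (v i) (ρ (c • a) (v j)) = c * inner ℂ (v i) (ρ a (v j))
        rw [map_smul, smul_apply, inner_smul_right] }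
  have hθ : ∀ a i j, θ a i j = inner ℂ (v i) (ρ a (v j)) := fun _ _ _ => rfl
  obtain ⟨Θ, h1, h2⟩ := exists_completelyPositiveMap_of_dilation θ (cstarMatrixRep k)
    (cstarMatrixRep_injective k) (fun a w => ∑ j, w j • ρ a (v j)) (fun a b w w' => by
      rw [inner_cstarMatrixRep, sum_inner]
      refine Finset.sum_congr rfl fun i _ => ?_
      rw [inner_sum]
      refine Finset.sum_congr rfl fun j _ => ?_
      rw [hθ, inner_smul_left, inner_smul_right, map_mul, map_star, mul_apply_eq_comp,
        ContinuousLinearMap.star_eq_adjoint, ContinuousLinearMap.adjoint_inner_right,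
        Complex.star_def]
      ring) (CStarMatrix.ext fun i j => by
      classical
      rw [hθ, map_one, one_apply_eq_self, orthonormal_iff_ite.1 hv,
        CStarMatrix.one_apply])
  exact ⟨Θ, fun a i j => by rw [h1, hθ], h2⟩

/-- A family `T` with `∑ᵢ Tᵢ*Tᵢ = 1` defines a contractive completely positive map
`m ↦ ∑ᵢⱼ mᵢⱼ Tᵢ*Tⱼ` on matrices. -/
theorem exists_completelyPositiveMap_of_sum_star_mul_self {k : ℕ} (T : Fin k → (H →L[ℂ] H))
    (hT : ∑ i, star (T i) * T i = 1) :
    ∃ Θ : CStarMatrix (Fin k) (Fin k) ℂ →CP (H →L[ℂ] H),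
      (∀ m, Θ m = ∑ i, ∑ j, m i j • (star (T i) * T j)) ∧ ∀ m, ‖Θ m‖ ≤ ‖m‖ := by
  let θ : CStarMatrix (Fin k) (Fin k) ℂ →ₗ[ℂ] (H →L[ℂ] H) :=
    { toFun := fun m => ∑ i, ∑ j, m i j • (star (T i) * T j)
      map_add' := fun a b => by
        simp only [CStarMatrix.add_apply, add_smul, Finset.sum_add_distrib]
      map_smul' := fun c a => by
        simp only [CStarMatrix.smul_apply, smul_assoc, Finset.smul_sum, RingHom.id_apply] }
  have hθ : ∀ m, θ m = ∑ i, ∑ j, m i j • (star (T i) * T j) := fun _ => rfl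
  obtain ⟨Θ, h1, h2⟩ := exists_completelyPositiveMap_of_dilation θ
    (StarAlgHom.id ℂ (H →L[ℂ] H)) Function.injective_id
    (fun m w => (WithLp.toLp 2 fun h => ∑ i, m h i • T i w : PiLp 2 fun _ : Fin k => H))
    (fun a b w w' => by
      have hin : ∀ i j, inner ℂ w ((star (T i) * T j) w') = inner ℂ (T i w) (T j w') :=
        fun i j => by
          rw [mul_apply_eq_comp, ContinuousLinearMap.star_eq_adjoint,
            ContinuousLinearMap.adjoint_inner_right]
      change inner ℂ w (θ (star a * b) w') = _
      simp only [hθ, sum_apply, smul_apply, inner_sum, inner_smul_right, hin,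
        PiLp.inner_apply, sum_inner, inner_smul_left, CStarMatrix.mul_apply,
        CStarMatrix.star_apply, Finset.sum_mul, Finset.mul_sum]
      calc _ = ∑ i, ∑ h, ∑ j, star (a h i) * b h j * inner ℂ (T i w) (T j w') :=
            Finset.sum_congr rfl fun i _ => Finset.sum_comm
        _ = ∑ h, ∑ i, ∑ j, star (a h i) * b h j * inner ℂ (T i w) (T j w') := Finset.sum_comm
        _ = _ := by
            refine Finset.sum_congr rfl fun h _ => ?_
            rw [Finset.sum_comm]
            refine Finset.sum_congr rfl fun j _ => Finset.sum_congr rfl fun i _ => ?_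
            rw [Complex.star_def]
            ring)
    (by
      rw [hθ, ← hT]
      refine Finset.sum_congr rfl fun i _ => ?_
      rw [Finset.sum_eq_single i (fun j _ hj => by simp [CStarMatrix.one_apply_ne' hj])
        (by simp), CStarMatrix.one_apply_eq, one_smul])
  exact ⟨Θ, fun m => by rw [h1, hθ], h2⟩

end compression

/-! ### Property A implies exactness -/

section multiplication

variable {Γ : Type u}

/-- Multiplication by a bounded real function on `ℓ²(Γ)`. -/
def mulOp (c : Γ → ℝ) {C : ℝ} (hC : ∀ g, |c g| ≤ C) : EllTwo Γ →L[ℂ] EllTwo Γ :=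
  have h2 : (0 : ℝ) < (2 : ENNReal).toReal := by norm_num
  have hle : ∀ (ξ : EllTwo Γ) (g : Γ), ‖(c g : ℂ) * ξ g‖ ^ (2 : ENNReal).toReal ≤
      C ^ (2 : ENNReal).toReal * ‖ξ g‖ ^ (2 : ENNReal).toReal := fun ξ g => by
    rw [← Real.mul_rpow ((abs_nonneg _).trans (hC g)) (norm_nonneg _), norm_mul,
      Complex.norm_real, Real.norm_eq_abs]
    exact Real.rpow_le_rpow (by positivity) (mul_le_mul_of_nonneg_right (hC g) (norm_nonneg _))
      h2.le
  have hs : ∀ ξ : EllTwo Γ, Summable fun g =>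
      C ^ (2 : ENNReal).toReal * ‖ξ g‖ ^ (2 : ENNReal).toReal := fun ξ =>
    ((lp.memℓp ξ).summable h2).mul_left _
  have hm : ∀ ξ : EllTwo Γ, Memℓp (fun g => (c g : ℂ) * ξ g) 2 := fun ξ =>
    memℓp_gen ((hs ξ).of_nonneg_of_le (fun g => by positivity) (hle ξ))
  LinearMap.mkContinuous
    { toFun := fun ξ => ⟨fun g => (c g : ℂ) * ξ g, hm ξ⟩
      map_add' := fun ξ ζ => by
        ext g
        exact mul_add _ _ _
      map_smul' := fun z ξ => by
        ext g
        exact mul_left_comm _ _ _ } C fun ξ => by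
    rcases isEmpty_or_nonempty Γ with hΓ | ⟨⟨g⟩⟩
    · simp [lp.eq_zero']
    have hC0 : 0 ≤ C := (abs_nonneg _).trans (hC g)
    refine lp.norm_le_of_tsum_le h2 (by positivity) ?_
    rw [Real.mul_rpow hC0 (norm_nonneg _), lp.norm_rpow_eq_tsum h2, ← tsum_mul_left]
    exact ((hs ξ).of_nonneg_of_le (fun g => by positivity) (hle ξ)).tsum_le_tsum (hle ξ) (hs ξ)

theorem mulOp_apply (c : Γ → ℝ) {C : ℝ} (hC : ∀ g, |c g| ≤ C) (ξ : EllTwo Γ) (g : Γ) :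
    mulOp c hC ξ g = (c g : ℂ) * ξ g := rfl

theorem norm_mulOp_le (c : Γ → ℝ) {C : ℝ} (h0 : 0 ≤ C) (hC : ∀ g, |c g| ≤ C) :
    ‖mulOp c hC‖ ≤ C := by
  unfold mulOp
  exact LinearMap.mkContinuous_norm_le _ h0 _

theorem star_mulOp (c : Γ → ℝ) {C : ℝ} (hC : ∀ g, |c g| ≤ C) : star (mulOp c hC) = mulOp c hC := by
  refine ((ContinuousLinearMap.eq_adjoint_iff _ _).2 fun ξ ζ => ?_).symm
  rw [lp.inner_eq_tsum, lp.inner_eq_tsum]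
  refine tsum_congr fun g => ?_
  simp only [mulOp_apply, RCLike.inner_apply, map_mul, Complex.conj_ofReal]
  ring

end multiplication

section span

variable {Γ : Type u} [Group Γ]

theorem adjoin_leftRegular_le_span {a : EllTwo Γ →L[ℂ] EllTwo Γ}
    (ha : a ∈ StarAlgebra.adjoin ℂ (Set.range (leftRegular (Γ := Γ)))) :
    a ∈ Submodule.span ℂ (Set.range (leftRegular (Γ := Γ))) := by
  induction ha using StarAlgebra.adjoin_induction with
  | mem x hx => exact Submodule.subset_span hx
  | algebraMap r =>
    rw [Algebra.algebraMap_eq_smul_one, ← leftRegular_one]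
    exact Submodule.smul_mem _ _ (Submodule.subset_span ⟨1, rfl⟩)
  | add x y _ _ hx hy => exact Submodule.add_mem _ hx hy
  | mul x y _ _ hx hy =>
    have h := Submodule.mul_mem_mul hx hy
    rw [Submodule.span_mul_span] at h
    refine Submodule.span_mono ?_ h
    rintro _ ⟨_, ⟨s, rfl⟩, _, ⟨t, rfl⟩, rfl⟩
    exact ⟨s * t, leftRegular_mul s t⟩
  | star x hxa hx =>
    clear hxa
    induction hx using Submodule.span_induction with
    | mem x hx =>
      obtain ⟨s, rfl⟩ := hx
      rw [star_leftRegular]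
      exact Submodule.subset_span ⟨_, rfl⟩
    | zero => simp
    | add x y _ _ hx hy =>
      rw [star_add]
      exact Submodule.add_mem _ hx hy
    | smul c x _ hx =>
      rw [star_smul]
      exact Submodule.smul_mem _ _ hx

/-- A net of contractive linear maps on the reduced C*-algebra that converges to the inclusion on
the unitaries `λ_s` converges to it everywhere. -/
theorem tendsto_of_tendsto_regularUnitary {ι : Type*} {l : Filter ι}
    {θ : ι → reducedCStar Γ →ₗ[ℂ] (EllTwo Γ →L[ℂ] EllTwo Γ)} (hθ : ∀ i a, ‖θ i a‖ ≤ ‖a‖)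
    (h : ∀ s, Tendsto (fun i => θ i (regularUnitary s)) l (𝓝 (leftRegular s)))
    (a : reducedCStar Γ) : Tendsto (fun i => θ i a) l (𝓝 (a : EllTwo Γ →L[ℂ] EllTwo Γ)) := by
  let W : Submodule ℂ (reducedCStar Γ) :=
    { carrier := {a | Tendsto (fun i => θ i a) l (𝓝 (a : EllTwo Γ →L[ℂ] EllTwo Γ))}
      add_mem' := fun {a b} ha hb => by simpa using Tendsto.add ha hb
      zero_mem' := by simpa using tendsto_const_nhds
      smul_mem' := fun c a ha => by simpa using Tendsto.const_smul ha c }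
  have hW : ∀ s, regularUnitary s ∈ W := h
  have hspan : ∀ b ∈ Submodule.span ℂ (Set.range (leftRegular (Γ := Γ))),
      ∃ b' ∈ W, (b' : EllTwo Γ →L[ℂ] EllTwo Γ) = b := by
    intro b hb
    induction hb using Submodule.span_induction with
    | mem x hx =>
      obtain ⟨s, rfl⟩ := hx
      exact ⟨_, hW s, rfl⟩
    | zero => exact ⟨0, W.zero_mem, rfl⟩
    | add x y _ _ hx hy =>
      obtain ⟨x', hx', rfl⟩ := hx
      obtain ⟨y', hy', rfl⟩ := hy
      exact ⟨_, W.add_mem hx' hy', rfl⟩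
    | smul c x _ hx =>
      obtain ⟨x', hx', rfl⟩ := hx
      exact ⟨_, W.smul_mem c hx', rfl⟩
  rw [Metric.tendsto_nhds]
  intro ε hε
  obtain ⟨b, hb, hab⟩ := Metric.mem_closure_iff.1 a.2 (ε / 3) (by positivity)
  obtain ⟨b, hbW, rfl⟩ := hspan b (adjoin_leftRegular_le_span hb)
  have hab' : ‖a - b‖ < ε / 3 := by
    rw [dist_eq_norm] at hab
    exact hab
  filter_upwards [Metric.tendsto_nhds.1 (show Tendsto _ l _ from hbW) (ε / 3) (by positivity)]
    with i hi
  calc dist (θ i a) a ≤ dist (θ i a) (θ i b) + dist (θ i b) b + dist (b : EllTwo Γ →L[ℂ] EllTwo Γ) a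
        := dist_triangle4 _ _ _ _
    _ < ε / 3 + ε / 3 + ε / 3 := by
        refine add_lt_add (add_lt_add ?_ hi) (by rwa [dist_comm])
        rw [dist_eq_norm, ← map_sub]
        exact (hθ i _).trans_lt hab'
    _ = ε := by ring

end span

namespace DiscreteProb

theorem abs_one_sub_sum_sqrt_le {Γ : Type*} {p q : DiscreteProb Γ} {T : Finset Γ}
    (hp : ∀ a ∉ T, p.1 a = 0) (hq : ∀ a ∉ T, q.1 a = 0) :
    |∑ a ∈ T, √(p.1 a) * √(q.1 a) - 1| ≤ l1Dist p q := by
  have h : ∑ a ∈ T, (√(p.1 a) - √(q.1 a)) ^ 2 = 2 - 2 * ∑ a ∈ T, √(p.1 a) * √(q.1 a) := by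
    have : ∀ a, (√(p.1 a) - √(q.1 a)) ^ 2 = p.1 a + q.1 a - 2 * (√(p.1 a) * √(q.1 a)) :=
      fun a => by
        rw [sub_sq, Real.sq_sqrt (p.2.1 a), Real.sq_sqrt (q.2.1 a)]
        ring
    simp only [this, Finset.sum_sub_distrib, Finset.sum_add_distrib, sum_eq_one hp, sum_eq_one hq,
      ← Finset.mul_sum]
    ring
  have h0 : 0 ≤ ∑ a ∈ T, (√(p.1 a) - √(q.1 a)) ^ 2 := Finset.sum_nonneg fun a _ => sq_nonneg _
  have h1 : ∑ a ∈ T, (√(p.1 a) - √(q.1 a)) ^ 2 ≤ l1Dist p q := by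
    rw [l1Dist_eq_sum hp hq]
    refine Finset.sum_le_sum fun a _ => ?_
    have e : |p.1 a - q.1 a| = |√(p.1 a) - √(q.1 a)| * |√(p.1 a) + √(q.1 a)| := by
      rw [← abs_mul]
      congr 1
      nlinarith [Real.sq_sqrt (p.2.1 a), Real.sq_sqrt (q.2.1 a)]
    rw [e, ← sq_abs, sq]
    refine mul_le_mul_of_nonneg_left ?_ (abs_nonneg _)
    rw [abs_le, abs_of_nonneg (by positivity)]
    constructor <;> linarith [Real.sqrt_nonneg (p.1 a), Real.sqrt_nonneg (q.1 a)]
  rw [abs_sub_comm, abs_of_nonneg (by linarith)]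
  linarith

theorem abs_sqrt_le_one {Γ : Type*} (p : DiscreteProb Γ) (a : Γ) : |√(p.1 a)| ≤ 1 := by
  rw [abs_of_nonneg (Real.sqrt_nonneg _), Real.sqrt_le_one]
  simpa using sum_le_one p {a}

end DiscreteProb

section propertyA

variable {Γ : Type u} [Group Γ]

/-- A finitely supported almost equivariant map `q : Γ → Prob(Γ)` yields a factorization through
the matrices over its support that almost fixes the unitaries `λ_h`: the resulting map multiplies
`λ_h` by the function `t ↦ ∑ₐ √(q_t(a) q_{h⁻¹t}(h⁻¹a))`. -/
theorem exists_matrix_factorization [PartialOrder (reducedCStar Γ)]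
    [StarOrderedRing (reducedCStar Γ)] {E : Finset Γ} {ε : ℝ} (hε : 0 ≤ ε) {F : Finset Γ}
    {q : Γ → DiscreteProb Γ} (hF : ∀ g, ∀ a ∉ F, (q g).1 a = 0)
    (hq : ∀ h ∈ E, ∀ g, l1Dist (q (h * g)) (translate h (q g)) ≤ ε) :
    ∃ (k : ℕ) (φ : reducedCStar Γ →CP CStarMatrix (Fin k) (Fin k) ℂ)
      (ψ : CStarMatrix (Fin k) (Fin k) ℂ →CP (EllTwo Γ →L[ℂ] EllTwo Γ)),
      (∀ a, ‖φ a‖ ≤ ‖a‖) ∧ (∀ m, ‖ψ m‖ ≤ ‖m‖) ∧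
        ∀ h ∈ E, ‖ψ (φ (regularUnitary h)) - leftRegular h‖ ≤ ε := by
  classical
  let e : F ≃ Fin F.card := F.equivFin
  let f : Fin F.card → Γ := fun i => (e.symm i).1
  have hf : Function.Injective f := Subtype.val_injective.comp e.symm.injective
  have hsum : ∀ u : Γ → ℝ, ∑ i, u (f i) = ∑ a ∈ F, u a := fun u => by
    rw [e.symm.sum_comp fun a : F => u a.1, Finset.sum_coe_sort F u]
  let v : Fin F.card → EllTwo Γ := fun i => lp.single 2 (f i) (1 : ℂ)
  have hvi : ∀ i (x : EllTwo Γ), inner ℂ (v i) x = x (f i) := fun i x => by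
    simp only [v]
    rw [lp.inner_single_left]
    simp
  have hv : Orthonormal ℂ v := by
    rw [orthonormal_iff_ite]
    intro i j
    rw [hvi]
    simp only [v, lp.single_apply]
    by_cases hij : i = j
    · subst hij
      simp
    · simp [hij, hf.ne hij]
  obtain ⟨φ, hφ, hφ1⟩ := exists_compression (reducedCStar Γ).subtype hv
  let M : Fin F.card → (EllTwo Γ →L[ℂ] EllTwo Γ) := fun i =>
    mulOp (fun t => √((q t).1 (f i))) fun t => abs_sqrt_le_one _ _
  let T : Fin F.card → (EllTwo Γ →L[ℂ] EllTwo Γ) := fun i => leftRegular (f i)⁻¹ * M i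
  have hTT : ∀ i j (x : EllTwo Γ) t, (star (T i) * T j) x t =
      (√((q t).1 (f i)) : ℂ) * ((√((q (f j * ((f i)⁻¹ * t))).1 (f j)) : ℂ) *
        x (f j * ((f i)⁻¹ * t))) := fun i j x t => by
    have : star (T i) = M i * leftRegular (f i) := by
      rw [star_mul, star_leftRegular, star_mulOp, inv_inv]
    rw [this]
    change (√((q t).1 (f i)) : ℂ) * ((√((q ((f j)⁻¹⁻¹ * ((f i)⁻¹ * t))).1 (f j)) : ℂ) *
        x ((f j)⁻¹⁻¹ * ((f i)⁻¹ * t))) = _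
    rw [inv_inv]
  obtain ⟨ψ, hψ, hψ1⟩ := exists_completelyPositiveMap_of_sum_star_mul_self T (by
    ext x t
    rw [sum_apply, lp.coeFn_sum, Finset.sum_apply]
    have h1 : ∑ i, √((q t).1 (f i)) * √((q t).1 (f i)) = 1 := by
      simp only [Real.mul_self_sqrt ((q t).2.1 _)]
      rw [hsum fun a => (q t).1 a, sum_eq_one (hF t)]
    have h2 : ∑ i, (√((q t).1 (f i)) : ℂ) * (√((q t).1 (f i)) : ℂ) = 1 := by exact_mod_cast h1
    calc _ = ∑ i, (√((q t).1 (f i)) : ℂ) * (√((q t).1 (f i)) : ℂ) * x t :=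
          Finset.sum_congr rfl fun i _ => by
            rw [hTT, mul_inv_cancel_left, mul_assoc]
      _ = x t := by rw [← Finset.sum_mul, h2, one_mul])
  refine ⟨F.card, φ, ψ, hφ1, hψ1, fun h hh => ?_⟩
  let c : Γ → ℝ := fun t => ∑ a ∈ F, √((q t).1 (h * a)) * √((q (h⁻¹ * t)).1 a)
  have hc : ∀ t, |c t - 1| ≤ ε := fun t => by
    let T' : Finset Γ := F ∪ F.image (h * ·)
    have h1 := abs_one_sub_sum_sqrt_le (p := q t) (q := translate h (q (h⁻¹ * t))) (T := T')
      (fun a ha => hF _ _ fun h' => ha (Finset.mem_union_left _ h'))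
      (fun a ha => hF _ _ fun h' => ha
        (Finset.mem_union_right _ (Finset.mem_image.2 ⟨_, h', by simp⟩)))
    have h2 : c t = ∑ a ∈ T', √((q t).1 a) * √((translate h (q (h⁻¹ * t))).1 a) := by
      rw [← Finset.sum_subset (Finset.subset_union_right (s₁ := F)) fun a _ ha => ?_,
        Finset.sum_image fun a _ b _ hab => mul_left_cancel hab]
      · simp [c, DiscreteProb.translate_apply]
      · rw [translate_eq_zero (hF _) h a ha]
        simp
    rw [h2]
    have h3 := hq h hh (h⁻¹ * t)
    rw [mul_inv_cancel_left] at h3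
    exact h1.trans h3
  have hφh : ∀ i j, φ (regularUnitary h) i j = if f i = h * f j then 1 else 0 := fun i j => by
    rw [hφ, hvi]
    change (v j) (h⁻¹ * f i) = _
    simp only [v, lp.single_apply]
    by_cases hij : f i = h * f j
    · simp [hij]
    · rw [if_neg hij]
      have : h⁻¹ * f i ≠ f j := fun h' => hij (by rw [← h', mul_inv_cancel_left])
      simp [this]
  have key : ψ (φ (regularUnitary h)) - leftRegular h =
      mulOp (fun t => c t - 1) hc * leftRegular h := by
    ext x t
    have h1 : ψ (φ (regularUnitary h)) x t = (c t : ℂ) * x (h⁻¹ * t) := by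
      rw [hψ]
      simp only [sum_apply, lp.coeFn_sum, Finset.sum_apply, smul_apply, lp.coeFn_smul,
        Pi.smul_apply, hTT, hφh, smul_eq_mul, ite_mul, one_mul, zero_mul]
      have hc' : (c t : ℂ) = ∑ j, (√((q t).1 (h * f j)) : ℂ) * (√((q (h⁻¹ * t)).1 (f j)) : ℂ) := by
        simp only [c]
        rw [← hsum fun a => √((q t).1 (h * a)) * √((q (h⁻¹ * t)).1 a)]
        push_cast
        rfl
      rw [hc', Finset.sum_mul, Finset.sum_comm]
      refine Finset.sum_congr rfl fun j _ => ?_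
      by_cases hj : h * f j ∈ F
      · have hi : f (e ⟨_, hj⟩) = h * f j := by simp [f]
        rw [Finset.sum_eq_single (e ⟨_, hj⟩) (fun i _ hij => if_neg fun h' => hij
          (hf (h'.trans hi.symm))) (by simp), if_pos hi, hi]
        simp [mul_assoc]
      · rw [hF t _ hj, Finset.sum_eq_zero fun i _ => if_neg fun h' : f i = h * f j =>
          hj (h' ▸ (e.symm i).2)]
        simp
    rw [sub_apply, lp.coeFn_sub, Pi.sub_apply, h1, leftRegular_apply, mul_apply_eq_comp,
      mulOp_apply, leftRegular_apply]
    push_cast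
    ring
  rw [key]
  have hl : ‖leftRegular h‖ ≤ 1 := ContinuousLinearMap.opNorm_le_bound _ zero_le_one fun x => by
    rw [norm_leftRegular_apply, one_mul]
  calc _ ≤ ‖mulOp (fun t => c t - 1) hc‖ * ‖leftRegular h‖ := norm_mul_le _ _
    _ ≤ ε * 1 := mul_le_mul (norm_mulOp_le _ hε hc) hl (norm_nonneg _) hε
    _ = ε := mul_one ε

theorem HasPropertyA.isExactGroup (hA : HasPropertyA Γ) : IsExactGroup Γ := by
  classical
  let _ : PartialOrder (reducedCStar Γ) := CStarAlgebra.spectralOrder (reducedCStar Γ)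
  let _ : StarOrderedRing (reducedCStar Γ) := CStarAlgebra.spectralOrderedRing (reducedCStar Γ)
  refine ⟨EllTwo Γ, inferInstance, inferInstance, inferInstance, (reducedCStar Γ).subtype,
    Subtype.val_injective, fun G ε hε => ?_⟩
  have hpos : ∀ i : Finset Γ × ℕ, (0 : ℝ) < 1 / (i.2 + 1) := fun i => by positivity
  choose F q hF hq using fun i : Finset Γ × ℕ => hA i.1 _ (hpos i)
  choose k φ ψ hφ hψ hφψ using fun i => exists_matrix_factorization (hpos i).le (hF i) (hq i)
  let θ : Finset Γ × ℕ → reducedCStar Γ →ₗ[ℂ] (EllTwo Γ →L[ℂ] EllTwo Γ) := fun i =>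
    (ψ i).toLinearMap ∘ₗ (φ i).toLinearMap
  have hlim := tendsto_of_tendsto_regularUnitary (l := atTop) (θ := θ)
    (fun i a => (hψ i _).trans (hφ i a)) fun s => by
      rw [Metric.tendsto_nhds]
      intro δ hδ
      obtain ⟨n, hn⟩ := exists_nat_one_div_lt hδ
      filter_upwards [eventually_ge_atTop (({s}, n) : Finset Γ × ℕ)] with i hi
      rw [dist_eq_norm]
      refine (hφψ i s (hi.1 (Finset.mem_singleton_self s))).trans_lt (lt_of_le_of_lt ?_ hn)
      have : (n : ℝ) ≤ i.2 := by exact_mod_cast hi.2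
      exact one_div_le_one_div_of_le (by positivity) (by linarith)
  have hev : ∀ᶠ i in atTop, ∀ a ∈ G, dist (θ i a) a < ε :=
    (Finset.eventually_all G).2 fun a _ => Metric.tendsto_nhds.1 (hlim a) ε hε
  obtain ⟨i, hi⟩ := hev.exists
  exact ⟨k i, φ i, ψ i, hφ i, hψ i, fun a ha => by
    have := hi a ha
    rwa [dist_eq_norm] at this⟩

end propertyA

/-! ### The filter of a boundary piece -/

namespace BoundaryPiece

variable {Γ : Type u} [Group Γ] (X : BoundaryPiece Γ)

/-- The filter on `Γ` of the traces of the neighbourhoods of `X` in `ΔΓ`. A limit along this filter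
is a limit along every point of `X`. -/
def filter : Filter Γ := ⨆ ω ∈ X.carrier, (ω : Filter Γ)

theorem mem_filter {A : Set Γ} : A ∈ X.filter ↔ ∀ ω ∈ X.carrier, A ∈ ω := by
  simp [filter]

theorem tendsto_filter {α : Type*} {f : Γ → α} {l : Filter α} :
    Tendsto f X.filter l ↔ ∀ ω ∈ X.carrier, Tendsto f (ω : Filter Γ) l := by
  simp only [filter, Filter.tendsto_def, Filter.mem_iSup]
  exact ⟨fun h ω hω s hs => h s hs ω hω, fun h s hs ω hω => h ω hω s hs⟩

theorem tendsto_mul_left (s : Γ) : Tendsto (fun g => s * g) X.filter X.filter := by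
  intro A hA
  rw [Filter.mem_map, mem_filter]
  exact fun ω hω => X.mem_filter.1 hA _ (X.left_mem s ω hω)

theorem tendsto_mul_right (t : Γ) : Tendsto (fun g => g * t) X.filter X.filter := by
  intro A hA
  rw [Filter.mem_map, mem_filter]
  exact fun ω hω => X.mem_filter.1 hA _ (X.right_mem t ω hω)

theorem compl_singleton_mem_filter (g : Γ) : {g}ᶜ ∈ X.filter := by
  refine X.mem_filter.2 fun ω hω => ?_
  rw [Ultrafilter.compl_mem_iff_notMem]
  intro h
  obtain ⟨x, hx, rfl⟩ := Ultrafilter.eq_pure_of_finite_mem (Set.finite_singleton g) h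
  exact X.ne_pure _ hω g (by rw [Set.mem_singleton_iff.1 hx])

end BoundaryPiece

/-! ### Gluing almost equivariant maps -/

namespace DiscreteProb

/-- The uniform distribution on `{0, …, N}`. -/
def uniform (N : ℕ) : DiscreteProb ℕ :=
  ofFinset (Finset.range (N + 1))
    (fun n => if n ∈ Finset.range (N + 1) then 1 / ((N : ℝ) + 1) else 0)
    (fun n => by split_ifs <;> positivity) (fun n hn => if_neg hn) (by
      rw [Finset.sum_congr rfl fun n hn => if_pos hn, Finset.sum_const, Finset.card_range,
        nsmul_eq_mul]
      push_cast
      field_simp)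

theorem uniform_apply (N n : ℕ) :
    (uniform N).1 n = if n ∈ Finset.range (N + 1) then 1 / ((N : ℝ) + 1) else 0 := rfl

theorem l1Dist_uniform_succ (N : ℕ) : l1Dist (uniform N) (uniform (N + 1)) ≤ 2 / ((N : ℝ) + 1) := by
  rw [l1Dist_eq_sum (T := Finset.range (N + 2))
    (fun a ha => if_neg fun h => ha (by rw [Finset.mem_range] at *; omega)) fun a ha => if_neg ha,
    Finset.sum_range_succ]
  have h1 : ∀ a ∈ Finset.range (N + 1), |(uniform N).1 a - (uniform (N + 1)).1 a| =
      1 / ((N : ℝ) + 1) - 1 / ((N : ℝ) + 2) := fun a ha => by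
    have ha' : a ∈ Finset.range (N + 1 + 1) := by rw [Finset.mem_range] at *; omega
    rw [uniform_apply, uniform_apply, if_pos ha, if_pos ha']
    push_cast
    rw [show (N : ℝ) + 1 + 1 = N + 2 by ring, abs_of_nonneg]
    exact sub_nonneg.2 (one_div_le_one_div_of_le (by positivity) (by linarith))
  have h2 : |(uniform N).1 (N + 1) - (uniform (N + 1)).1 (N + 1)| = 1 / ((N : ℝ) + 2) := by
    rw [uniform_apply, uniform_apply, if_neg (by simp), if_pos (by simp), zero_sub, abs_neg]
    push_cast
    rw [show (N : ℝ) + 1 + 1 = N + 2 by ring, abs_of_nonneg (by positivity)]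
  rw [Finset.sum_congr rfl h1, h2, Finset.sum_const, Finset.card_range, nsmul_eq_mul]
  push_cast
  have : ((N : ℝ) + 1) * (1 / ((N : ℝ) + 1) - 1 / ((N : ℝ) + 2)) + 1 / ((N : ℝ) + 2)
      = 2 / ((N : ℝ) + 2) := by
    field_simp
    ring
  rw [this]
  exact div_le_div_of_nonneg_left (by norm_num) (by positivity) (by linarith)

theorem l1Dist_uniform_le {M N : ℕ} (hN : 0 < N) (h1 : M ≤ N + 1) (h2 : N ≤ M + 1) :
    l1Dist (uniform M) (uniform N) ≤ 2 / (N : ℝ) := by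
  have hN' : (0 : ℝ) < N := by exact_mod_cast hN
  rcases (show M = N ∨ M = N + 1 ∨ N = M + 1 by omega) with rfl | rfl | rfl
  · rw [l1Dist_self]
    positivity
  · rw [l1Dist_comm]
    exact (l1Dist_uniform_succ N).trans
      (div_le_div_of_nonneg_left (by norm_num) hN' (by linarith))
  · push_cast
    exact l1Dist_uniform_succ M

/-- An average over `{0, …, N}` of distances that are small except for the first `m` and the last
index. -/
theorem tsum_uniform_mul_le {N m : ℕ} {u : ℕ → ℝ} {δ : ℝ} (hδ : 0 ≤ δ) (hu : ∀ n, u n ≤ 2)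
    (h : ∀ n, m ≤ n → n < N → u n ≤ δ) :
    ∑' n, (uniform N).1 n * u n ≤ δ + 2 * ((m : ℝ) + 1) / ((N : ℝ) + 1) := by
  rw [tsum_eq_sum (s := Finset.range (N + 1)) fun n hn => by
    rw [uniform_apply, if_neg hn, zero_mul]]
  have hle : ∀ n ∈ Finset.range (N + 1), (uniform N).1 n * u n ≤
      1 / ((N : ℝ) + 1) * δ +
        1 / ((N : ℝ) + 1) * (if n ∈ insert N (Finset.range m) then 2 else 0) := by
    intro n hn
    rw [uniform_apply, if_pos hn, ← mul_add]
    refine mul_le_mul_of_nonneg_left ?_ (by positivity)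
    split_ifs with h'
    · linarith [hu n]
    · rw [Finset.mem_insert, Finset.mem_range, not_or] at h'
      rw [Finset.mem_range] at hn
      linarith [h n (by omega) (by omega)]
  refine (Finset.sum_le_sum hle).trans ?_
  rw [Finset.sum_add_distrib, Finset.sum_const, Finset.card_range, nsmul_eq_mul, ← Finset.mul_sum,
    Finset.sum_ite_mem, Finset.sum_const, nsmul_eq_mul]
  have hcard : ((Finset.range (N + 1) ∩ insert N (Finset.range m)).card : ℝ) ≤ m + 1 := by
    have := (Finset.card_le_card (Finset.inter_subset_right (s₁ := Finset.range (N + 1))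
      (s₂ := insert N (Finset.range m)))).trans (Finset.card_insert_le _ _)
    rw [Finset.card_range] at this
    exact_mod_cast this
  push_cast
  have e1 : ((N : ℝ) + 1) * (1 / ((N : ℝ) + 1) * δ) = δ := by field_simp
  rw [e1, div_eq_mul_one_div (2 * ((m : ℝ) + 1)), mul_comm (1 / ((N : ℝ) + 1))]
  have : (0 : ℝ) ≤ 1 / ((N : ℝ) + 1) := by positivity
  nlinarith

end DiscreteProb

section gluing

variable {Γ : Type u} [Group Γ]

/-- If for all `E` and `ε` some map `Γ → Prob(Γ)` is equivariant up to `ε` along `L` for the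
elements of `E`, then a single map is asymptotically equivariant along `L`. It averages the `n`-th
approximations over `n ≤ d(g)`, where the depth `d(g)` of `g` tends to infinity along `L` and
changes by at most one under translations by fixed group elements. -/
theorem exists_asymptotically_equivariant [Countable Γ] {L : Filter Γ}
    (hl : ∀ s : Γ, Tendsto (fun g => s * g) L L) (hr : ∀ t : Γ, Tendsto (fun g => g * t) L L)
    (hL : ∀ g : Γ, {g}ᶜ ∈ L)
    (H : ∀ (E : Finset Γ) (ε : ℝ), 0 < ε → ∃ ν : Γ → DiscreteProb Γ, ∀ s ∈ E, ∀ t ∈ E,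
      ∀ᶠ g in L, l1Dist (ν (s * g * t)) (translate s (ν g)) ≤ ε) :
    ∃ μ : Γ → DiscreteProb Γ, ∀ s t : Γ,
      Tendsto (fun g => l1Dist (μ (s * g * t)) (translate s (μ g))) L (𝓝 0) := by
  classical
  obtain ⟨e, he⟩ := exists_surjective_nat Γ
  let E : ℕ → Finset Γ := fun n => (Finset.range n).image e
  have hE : ∀ {m n}, m ≤ n → E m ⊆ E n := fun h =>
    Finset.image_subset_image (Finset.range_mono h)
  have hEmem : ∀ g, ∀ᶠ n in atTop, g ∈ E n := fun g => by
    obtain ⟨k, rfl⟩ := he g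
    filter_upwards [eventually_gt_atTop k] with n hn
    exact Finset.mem_image_of_mem e (Finset.mem_range.2 hn)
  choose ν hν using fun n : ℕ => H (E n) (1 / ((n : ℝ) + 1)) (by positivity)
  -- a decreasing sequence of sets in `L` with empty intersection, because the `n`-th element of `Γ`
  -- is removed in step `n`; the depth `d g` is the last index `n` with `g ∈ A n`
  let next : ℕ → Set Γ → Set Γ := fun n S => {g | g ∈ S ∧ g ≠ e n ∧
    (∀ s ∈ E n, ∀ t ∈ E n, l1Dist (ν n (s * g * t)) (translate s (ν n g)) ≤ 1 / ((n : ℝ) + 1)) ∧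
    ∀ s ∈ E n, ∀ t ∈ E n, s * g * t ∈ S}
  obtain ⟨A, hA0, hAs⟩ : ∃ A : ℕ → Set Γ, A 0 = Set.univ ∧ ∀ n, A (n + 1) = next n (A n) :=
    ⟨fun n => Nat.rec Set.univ next n, rfl, fun _ => rfl⟩
  have hAL : ∀ n, A n ∈ L := fun n => by
    induction n with
    | zero => rw [hA0]; exact univ_mem
    | succ n ih =>
      rw [hAs]
      have h1 : ∀ᶠ g in L, ∀ s ∈ E n, ∀ t ∈ E n,
          l1Dist (ν n (s * g * t)) (translate s (ν n g)) ≤ 1 / ((n : ℝ) + 1) :=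
        (Finset.eventually_all _).2 fun s hs => (Finset.eventually_all _).2 fun t ht =>
          hν n s hs t ht
      have h2 : ∀ᶠ g in L, ∀ s ∈ E n, ∀ t ∈ E n, s * g * t ∈ A n :=
        (Finset.eventually_all _).2 fun s _ => (Finset.eventually_all _).2 fun t _ =>
          ((hr t).comp (hl s)) ih
      filter_upwards [ih, hL (e n), h1, h2] with g hg1 hg2 hg3 hg4
      exact ⟨hg1, hg2, hg3, hg4⟩
  have hAanti : Antitone A := antitone_nat_of_succ_le fun n => by
    rw [hAs]
    exact fun g hg => hg.1
  have hex : ∀ g, ∃ n, g ∉ A (n + 1) := fun g => by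
    obtain ⟨n, rfl⟩ := he g
    refine ⟨n, fun h => ?_⟩
    rw [hAs] at h
    exact h.2.1 rfl
  let d : Γ → ℕ := fun g => Nat.find (hex g)
  have hd : ∀ g n, g ∈ A n ↔ n ≤ d g := fun g n => by
    constructor
    · intro h
      by_contra! hn
      exact Nat.find_spec (hex g) (hAanti hn h)
    · intro h
      cases n with
      | zero => rw [hA0]; trivial
      | succ n => exact not_not.1 (Nat.find_min (hex g) h)
  have hdL : ∀ n, ∀ᶠ g in L, n ≤ d g := fun n => by
    filter_upwards [hAL n] with g hg
    exact (hd g n).1 hg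
  refine ⟨fun g => bind (uniform (d g)) fun n => ν n g, fun s t => ?_⟩
  rw [Metric.tendsto_nhds]
  intro ε hε
  obtain ⟨m, hs, ht, hs', ht', hm⟩ : ∃ m, s ∈ E m ∧ t ∈ E m ∧ s⁻¹ ∈ E m ∧ t⁻¹ ∈ E m ∧
      1 / ((m : ℝ) + 1) < ε / 4 := by
    have h1 : ∀ᶠ n : ℕ in atTop, 1 / ((n : ℝ) + 1) < ε / 4 :=
      tendsto_one_div_add_atTop_nhds_zero_nat.eventually (gt_mem_nhds (by positivity))
    exact ((hEmem s).and ((hEmem t).and ((hEmem s⁻¹).and ((hEmem t⁻¹).and h1)))).exists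
  obtain ⟨M, hM⟩ := exists_nat_gt (8 * ((m : ℝ) + 1) / ε)
  filter_upwards [hdL (m + 2), hdL M] with g hg1 hg2
  set g' := s * g * t with hg'
  have hM0 : (0 : ℝ) < M := lt_of_le_of_lt (by positivity) hM
  have hdM : (M : ℝ) ≤ d g := by exact_mod_cast hg2
  have hbig : 2 * ((m : ℝ) + 1) < ε / 4 * d g := by
    rw [div_lt_iff₀ hε] at hM
    nlinarith
  -- the depths of `g` and `g'` differ by at most one
  have hle1 : d g ≤ d g' + 1 := by
    have h := (hd g (d g)).2 le_rfl
    rw [show d g = (d g - 1) + 1 by omega, hAs] at h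
    have : d g - 1 ≤ d g' := (hd g' _).1 (h.2.2.2 s (hE (by omega) hs) t (hE (by omega) ht))
    omega
  have hle2 : d g' ≤ d g + 1 := by
    have h := (hd g' (d g')).2 le_rfl
    rw [show d g' = (d g' - 1) + 1 by omega, hAs] at h
    have h2 := h.2.2.2 s⁻¹ (hE (by omega) hs') t⁻¹ (hE (by omega) ht')
    rw [show s⁻¹ * g' * t⁻¹ = g by rw [hg']; group, hd] at h2
    omega
  -- change first the weights of the average, then the measures that are averaged
  have h1 : l1Dist (bind (uniform (d g')) fun n => ν n g') (bind (uniform (d g)) fun n => ν n g') <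
      ε / 2 := by
    refine ((l1Dist_bind_left_le _ _ _).trans (l1Dist_uniform_le (by omega) hle2 hle1)).trans_lt ?_
    rw [div_lt_iff₀ (hM0.trans_le hdM)]
    have : (0 : ℝ) ≤ m := Nat.cast_nonneg m
    nlinarith
  have h2 : l1Dist (bind (uniform (d g)) fun n => ν n g')
      (translate s (bind (uniform (d g)) fun n => ν n g)) < ε / 2 := by
    rw [translate_bind]
    refine ((l1Dist_bind_right_le _ _ _).trans (tsum_uniform_mul_le (m := m)
      (δ := 1 / ((m : ℝ) + 1)) (by positivity) (fun n => l1Dist_le_two _ _)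
      fun n hmn hn => ?_)).trans_lt ?_
    · have h := (hd g (n + 1)).2 hn
      rw [hAs] at h
      refine (h.2.2.1 s (hE hmn hs) t (hE hmn ht)).trans ?_
      have : (m : ℝ) ≤ n := by exact_mod_cast hmn
      exact one_div_le_one_div_of_le (by positivity) (by linarith)
    · have : 2 * ((m : ℝ) + 1) / ((d g : ℝ) + 1) < ε / 4 := by
        rw [div_lt_iff₀ (by positivity)]
        nlinarith
      linarith
  rw [Real.dist_eq, sub_zero, abs_of_nonneg (l1Dist_nonneg _ _)]
  linarith [l1Dist_triangle (bind (uniform (d g')) fun n => ν n g')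
    (bind (uniform (d g)) fun n => ν n g')
    (translate s (bind (uniform (d g)) fun n => ν n g))]

end gluing

/-! ### Finitely supported almost equivariant boundary maps -/

/-- There are almost equivariant maps `Γ → Prob(Γ)` with uniformly finite supports whose extensions
to `ΔΓ` are invariant under right translations on `X`. Each of the three conditions of the
characterization of bi-exactness towards `X` is compared with this one. -/
def BoundaryPiece.HasBoundaryMaps {Γ : Type u} [Group Γ] (X : BoundaryPiece Γ) : Prop :=
  ∀ (E : Finset Γ) (ε : ℝ), 0 < ε → ∃ (F : Finset Γ) (ν : Γ → DiscreteProb Γ),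
    (∀ g, ∀ a ∉ F, (ν g).1 a = 0) ∧
    (∀ s ∈ E, ∀ g, l1Dist (ν (s * g)) (translate s (ν g)) ≤ ε) ∧
    ∀ t, Tendsto (fun g => l1Dist (ν (g * t)) (ν g)) X.filter (𝓝 0)

namespace DiscreteProb

/-- The measure on `Bool` with mass `r` at `true`. -/
def bernoulli (r : ℝ) (h0 : 0 ≤ r) (h1 : r ≤ 1) : DiscreteProb Bool :=
  ofFinset Finset.univ (fun b => if b then r else 1 - r)
    (fun b => by split_ifs <;> linarith) (by simp) (by simp)

theorem l1Dist_bernoulli {r r' : ℝ} (h0 : 0 ≤ r) (h1 : r ≤ 1) (h0' : 0 ≤ r') (h1' : r' ≤ 1) :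
    l1Dist (bernoulli r h0 h1) (bernoulli r' h0' h1') = 2 * |r - r'| := by
  rw [l1Dist_eq_sum (T := Finset.univ) (by simp) (by simp)]
  simp only [Fintype.sum_bool, bernoulli, ofFinset, if_true, Bool.false_eq_true, if_false]
  rw [show 1 - r - (1 - r') = -(r - r') by ring, abs_neg]
  ring

theorem l1Dist_bind_bernoulli_le {Γ : Type*} {r : ℝ} (h0 : 0 ≤ r) (h1 : r ≤ 1)
    (p q : Bool → DiscreteProb Γ) : l1Dist (bind (bernoulli r h0 h1) p)
      (bind (bernoulli r h0 h1) q) ≤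
        r * l1Dist (p true) (q true) + (1 - r) * l1Dist (p false) (q false) := by
  refine (l1Dist_bind_right_le _ _ _).trans_eq ?_
  rw [tsum_bool, add_comm]
  simp [bernoulli, ofFinset]

end DiscreteProb

section mixing

variable {Γ : Type u} [Group Γ]

/-- A slowly varying integer-valued function: for `B ∈ L` and a finite symmetric set `E` there is
`c : Γ → {0, …, m}` that equals `m` near `L`, vanishes off `B`, and changes by at most one under
left translation by elements of `E`. -/
theorem exists_slowly_varying {L : Filter Γ} (hl : ∀ s : Γ, Tendsto (fun g => s * g) L L)
    {E : Finset Γ} (hE : ∀ s ∈ E, s⁻¹ ∈ E) {B : Set Γ} (hB : B ∈ L) (m : ℕ) :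
    ∃ c : Γ → ℕ, (∀ g, c g ≤ m) ∧ (∀ᶠ g in L, c g = m) ∧ (∀ g, c g ≠ 0 → g ∈ B) ∧
      ∀ s ∈ E, ∀ g, c (s * g) ≤ c g + 1 ∧ c g ≤ c (s * g) + 1 := by
  classical
  let next : Set Γ → Set Γ := fun S => {g | g ∈ S ∧ g ∈ B ∧ ∀ s ∈ E, s * g ∈ S}
  obtain ⟨A, hA0, hAs⟩ : ∃ A : ℕ → Set Γ, A 0 = Set.univ ∧ ∀ n, A (n + 1) = next (A n) :=
    ⟨fun n => Nat.rec Set.univ (fun _ => next) n, rfl, fun _ => rfl⟩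
  have hAL : ∀ n, A n ∈ L := fun n => by
    induction n with
    | zero => rw [hA0]; exact univ_mem
    | succ n ih =>
      rw [hAs]
      have h : ∀ᶠ g in L, ∀ s ∈ E, s * g ∈ A n :=
        (Finset.eventually_all _).2 fun s _ => hl s ih
      filter_upwards [ih, hB, h] with g h1 h2 h3
      exact ⟨h1, h2, h3⟩
  let c : Γ → ℕ := fun g => Nat.findGreatest (fun n => g ∈ A n) m
  have hcA : ∀ g, g ∈ A (c g) := fun g =>
    Nat.findGreatest_spec (P := fun n => g ∈ A n) (Nat.zero_le m) (by rw [hA0]; trivial)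
  have hcle : ∀ g, c g ≤ m := fun g => Nat.findGreatest_le m
  have hstep : ∀ s ∈ E, ∀ g, c g ≤ c (s * g) + 1 := fun s hs g => by
    rcases Nat.eq_zero_or_pos (c g) with h0 | h0
    · omega
    · have h := hcA g
      rw [show c g = (c g - 1) + 1 by omega, hAs] at h
      have h2 : c g - 1 ≤ c (s * g) := Nat.le_findGreatest
        (by have := hcle g; omega) (h.2.2 s hs)
      omega
  refine ⟨c, hcle, ?_, fun g hg => ?_, fun s hs g => ⟨?_, hstep s hs g⟩⟩
  · filter_upwards [hAL m] with g hg
    exact le_antisymm (hcle g) (Nat.le_findGreatest le_rfl hg)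
  · have h := hcA g
    rw [show c g = (c g - 1) + 1 by omega, hAs] at h
    exact h.2.1
  · have := hstep s⁻¹ (hE s hs) (s * g)
    rwa [inv_mul_cancel_left] at this

/-- The composition of an almost equivariant `q : Γ → Prob(F)` with a map that agrees with `μ`
near `X` and moves slowly to the exactly equivariant map `g ↦ δ_g` away from `X`. -/
theorem BoundaryPiece.hasBoundaryMaps_of_hasPropertyA (X : BoundaryPiece Γ)
    (hA : HasPropertyA Γ) {μ : Γ → DiscreteProb Γ}
    (hμ : ∀ s t : Γ, Tendsto (fun g => l1Dist (μ (s * g * t)) (translate s (μ g))) X.filter (𝓝 0)) :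
    X.HasBoundaryMaps := by
  classical
  intro E ε hε
  obtain ⟨F, q, hF, hq⟩ := hA E (ε / 3) (by positivity)
  obtain ⟨m, hm⟩ := exists_nat_gt (6 / ε)
  have hm0 : (0 : ℝ) < m := lt_trans (by positivity) hm
  let E' : Finset Γ := E ∪ E.image (·⁻¹)
  have hE' : ∀ s ∈ E', s⁻¹ ∈ E' := fun s hs => by
    rcases Finset.mem_union.1 hs with h | h
    · exact Finset.mem_union_right _ (Finset.mem_image_of_mem _ h)
    · obtain ⟨r, hr, rfl⟩ := Finset.mem_image.1 h
      exact Finset.mem_union_left _ (by simpa using hr)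
  have hB : {g | ∀ s ∈ E', l1Dist (μ (s * g)) (translate s (μ g)) ≤ ε / 3} ∈ X.filter :=
    (Finset.eventually_all _).2 fun s _ => by
      have h := (hμ s 1).eventually (ge_mem_nhds (show (0 : ℝ) < ε / 3 by positivity))
      simpa using h
  obtain ⟨c, hcm, hcX, hcB, hcE⟩ := exists_slowly_varying X.tendsto_mul_left hE' hB m
  have h0 : ∀ g, 0 ≤ (c g : ℝ) / m := fun g => by positivity
  have h1 : ∀ g, (c g : ℝ) / m ≤ 1 := fun g =>
    (div_le_one hm0).2 (by exact_mod_cast hcm g)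
  let w : Γ → DiscreteProb Bool := fun g => bernoulli ((c g : ℝ) / m) (h0 g) (h1 g)
  let p : Γ → Bool → DiscreteProb Γ := fun g b => if b then μ g else pointMass g
  have hmix : ∀ s ∈ E, ∀ g,
      l1Dist (bind (w (s * g)) (p (s * g))) (translate s (bind (w g) (p g))) ≤ ε / 3 + ε / 3 := by
    intro s hs g
    have hs' : s ∈ E' := Finset.mem_union_left _ hs
    have d1 : l1Dist (bind (w (s * g)) (p (s * g))) (bind (w g) (p (s * g))) ≤ ε / 3 := by
      refine (l1Dist_bind_left_le _ _ _).trans ?_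
      rw [l1Dist_bernoulli, ← sub_div, abs_div, abs_of_pos hm0]
      have : |(c (s * g) : ℝ) - c g| ≤ 1 := by
        obtain ⟨h1, h2⟩ := hcE s hs' g
        have h1' : (c (s * g) : ℝ) ≤ c g + 1 := by exact_mod_cast h1
        have h2' : (c g : ℝ) ≤ c (s * g) + 1 := by exact_mod_cast h2
        rw [abs_le]
        constructor <;> linarith
      calc 2 * (|(c (s * g) : ℝ) - c g| / m) ≤ 2 * (1 / m) := by gcongr
        _ ≤ ε / 3 := by
          rw [div_lt_iff₀ hε] at hm
          rw [mul_one_div, div_le_iff₀ hm0]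
          linarith
    have d2 : l1Dist (bind (w g) (p (s * g))) (translate s (bind (w g) (p g))) ≤ ε / 3 := by
      rw [translate_bind]
      refine (l1Dist_bind_bernoulli_le _ _ _ _).trans ?_
      simp only [p, if_true, Bool.false_eq_true, if_false]
      rw [translate_pointMass, l1Dist_self, mul_zero, add_zero]
      -- where `c g = 0` only the exactly equivariant part `δ_g` is present
      by_cases hc : c g = 0
      · rw [hc]
        simp only [Nat.cast_zero, zero_div, zero_mul]
        positivity
      · calc _ ≤ 1 * (ε / 3) := mul_le_mul (h1 g) (hcB g hc s hs') (l1Dist_nonneg _ _) zero_le_one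
          _ = ε / 3 := one_mul _
    exact (l1Dist_triangle _ _ _).trans (add_le_add d1 d2)
  refine ⟨F, fun g => bind (bind (w g) (p g)) q, fun g => bind_eq_zero hF, fun s hs g => ?_,
    fun t => ?_⟩
  · rw [translate_bind]
    have d1 := l1Dist_bind_left_le (bind (w (s * g)) (p (s * g))) (translate s (bind (w g) (p g))) q
    have d2 : l1Dist (bind (translate s (bind (w g) (p g))) q)
        (bind (bind (w g) (p g)) fun i => translate s (q i)) ≤ ε / 3 := by
      rw [bind_translate]
      exact l1Dist_bind_right_le_of_forall fun a => hq s hs a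
    linarith [l1Dist_triangle (bind (bind (w (s * g)) (p (s * g))) q)
      (bind (translate s (bind (w g) (p g))) q)
      (bind (bind (w g) (p g)) fun i => translate s (q i)), hmix s hs g]
  · refine squeeze_zero' (g := fun g => l1Dist (μ (1 * g * t)) (translate 1 (μ g)))
      (Eventually.of_forall fun g => l1Dist_nonneg _ _) ?_ (hμ 1 t)
    filter_upwards [hcX, X.tendsto_mul_right t hcX] with g hg hgt
    have hw : ∀ g, c g = m → w g = bernoulli 1 zero_le_one le_rfl := fun g hg => by
      simp only [w, hg, div_self hm0.ne']
    rw [hw g hg, hw _ hgt, one_mul, translate_one]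
    refine (l1Dist_bind_left_le _ _ _).trans ((l1Dist_bind_bernoulli_le _ _ _ _).trans_eq ?_)
    simp [p]

end mixing

/-! ### Points of the spectrum of the right-invariant functions -/

namespace BoundaryPiece

variable {Γ : Type u} [Group Γ] (X : BoundaryPiece Γ)

/-- Evaluation at the points of `X`, as a map to the spectrum of `C(X)^{Γ_r}`. -/
def evalSpectrum : C(X.carrier, X.Spectrum) :=
  (WeakDual.CharacterSpace.compContinuousMap X.rightInvariant.subtype).comp
    (WeakDual.CharacterSpace.continuousMapEval X.carrier ℂ)

theorem evalSpectrum_apply (ω : X.carrier) (f : X.rightInvariant) :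
    X.evalSpectrum ω f = f.1 ω := rfl

theorem evalSpectrum_leftMap (s : Γ) (ω : X.carrier) :
    X.evalSpectrum (X.leftMap s ω) = s • X.evalSpectrum ω := by
  ext f
  rw [smul_spectrum_apply, evalSpectrum_apply, evalSpectrum_apply]
  change _ = f.1 (X.leftMap s⁻¹⁻¹ ω)
  rw [inv_inv]

theorem evalSpectrum_rightMap (t : Γ) (ω : X.carrier) :
    X.evalSpectrum (X.rightMap t ω) = X.evalSpectrum ω := by
  ext f
  exact f.2 t ω

/-- If a character differed from all evaluations, then by compactness some sum `∑ |fᵢ|²` with `fᵢ`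
in its kernel would be invertible. -/
theorem evalSpectrum_surjective : Function.Surjective X.evalSpectrum := by
  intro χ
  by_contra! hne
  have h : ∀ ω : X.carrier, ∃ f : X.rightInvariant, χ f = 0 ∧ f.1 ω ≠ 0 := by
    intro ω
    have : ∃ f : X.rightInvariant, X.evalSpectrum ω f ≠ χ f := by
      by_contra! hall
      exact hne ω (by ext f; exact hall f)
    obtain ⟨f, hf⟩ := this
    refine ⟨f - algebraMap ℂ _ (χ f), ?_, ?_⟩
    · rw [map_sub, AlgHomClass.commutes, Algebra.algebraMap_self, RingHom.id_apply, sub_self]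
    · exact sub_ne_zero.2 hf
  choose f hf0 hfω using h
  obtain ⟨T, hT⟩ := isCompact_univ.elim_finite_subcover (fun ω => {x | (f ω).1 x ≠ 0})
    (fun ω => isOpen_ne_fun (f ω).1.continuous continuous_const)
    fun ω _ => Set.mem_iUnion.2 ⟨ω, hfω ω⟩
  let G : X.rightInvariant := ∑ ω ∈ T, star (f ω) * f ω
  have hG0 : χ G = 0 := by simp [G, hf0]
  have hG : ∀ x, G.1 x ≠ 0 := fun x => by
    have h1 : G.1 x = ((∑ ω ∈ T, Complex.normSq ((f ω).1 x) : ℝ) : ℂ) := by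
      have h2 : G.1 = ∑ ω ∈ T, star (f ω).1 * (f ω).1 := by
        simp [G]
      rw [h2]
      simp [ContinuousMap.sum_apply, Complex.normSq_eq_conj_mul_self]
    rw [h1, Complex.ofReal_ne_zero]
    obtain ⟨ω, hω, hx⟩ := Set.mem_iUnion₂.1 (hT (Set.mem_univ x))
    exact (Finset.sum_pos' (f := fun ω => Complex.normSq ((f ω).1 x))
      (fun _ _ => Complex.normSq_nonneg _) ⟨ω, hω, Complex.normSq_pos.2 hx⟩).ne'
  let G' : X.rightInvariant := ⟨⟨fun x => (G.1 x)⁻¹, G.1.continuous.inv₀ hG⟩, fun t ω => by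
    change (G.1 (X.rightMap t ω))⁻¹ = (G.1 ω)⁻¹
    rw [G.2 t ω]⟩
  have hGG' : G * G' = 1 := by
    refine Subtype.ext (ContinuousMap.ext fun x => ?_)
    exact mul_inv_cancel₀ (hG x)
  have h1 : χ (G * G') = 1 := by rw [hGG', map_one]
  rw [map_mul, hG0, zero_mul] at h1
  exact zero_ne_one h1

/-! ### Comparison with amenability of the spectrum -/

/-- The coordinates of boundary maps extend to continuous functions on `ΔΓ`, whose restrictions to
`X` lie in `C(X)^{Γ_r}`; evaluated at the characters they give maps from the spectrum to
`Prob(Γ)`. -/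
theorem HasBoundaryMaps.isBiExact {X : BoundaryPiece Γ} (hX : X.HasBoundaryMaps) :
    X.IsBiExact := by
  classical
  intro E ε hε
  obtain ⟨F, ν, hF, hE, hR⟩ := hX E ε hε
  have h01 : ∀ a g, (ν g).1 a ∈ Set.Icc (0 : ℝ) 1 := fun a g =>
    ⟨(ν g).2.1 a, by simpa using sum_le_one (ν g) {a}⟩
  let u : Γ → Γ → Set.Icc (0 : ℝ) 1 := fun a g => ⟨(ν g).1 a, h01 a g⟩
  let N : Γ → Ultrafilter Γ → ℝ := fun a ω => (Ultrafilter.extend (u a) ω).1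
  have hNc : ∀ a, Continuous (N a) := fun a =>
    continuous_subtype_val.comp (continuous_ultrafilter_extend (u a))
  have hN : ∀ a (ω : Ultrafilter Γ), Tendsto (fun g => (ν g).1 a) ω (𝓝 (N a ω)) := fun a ω =>
    (continuous_subtype_val.tendsto _).comp
      ((ultrafilter_extend_eq_iff (f := u a) (b := ω)).1 rfl)
  have hNr : ∀ a t (ω : X.carrier), N a (X.rightMap t ω).1 = N a ω.1 := fun a t ω => by
    have h1 : Tendsto (fun g => (ν (g * t)).1 a) ω.1 (𝓝 (N a (X.rightMap t ω).1)) :=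
      hN a (ω.1.map fun g => g * t)
    have h2 := h1.sub (hN a ω.1)
    have h3 : Tendsto (fun g => (ν (g * t)).1 a - (ν g).1 a) ω.1 (𝓝 0) := by
      refine squeeze_zero_norm (fun g => ?_) (X.tendsto_filter.1 (hR t) ω.1 ω.2)
      simpa using sum_abs_sub_le_l1Dist (ν (g * t)) (ν g) {a}
    exact sub_eq_zero.1 (tendsto_nhds_unique h2 h3)
  let φ : Γ → X.rightInvariant := fun a =>
    ⟨⟨fun ω => (N a ω.1 : ℂ), Complex.continuous_ofReal.comp
      ((hNc a).comp continuous_subtype_val)⟩, fun t ω => congrArg Complex.ofReal (hNr a t ω)⟩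
  have hφ : ∀ a (ω : X.carrier), (X.evalSpectrum ω (φ a)).re = N a ω.1 := fun a ω =>
    Complex.ofReal_re _
  have hN0 : ∀ a ω, 0 ≤ N a ω := fun a ω => (Ultrafilter.extend (u a) ω).2.1
  have hNF : ∀ a ∉ F, ∀ ω, N a ω = 0 := fun a ha ω =>
    tendsto_nhds_unique (hN a ω) (by simp [hF _ a ha])
  have hN1 : ∀ ω, ∑ a ∈ F, N a ω = 1 := fun ω =>
    tendsto_nhds_unique (tendsto_finsetSum F fun a _ => hN a ω)
      (by simp [sum_eq_one (hF _)])
  refine ⟨fun χ => ofFinset F (fun a => (χ (φ a)).re) (fun a => ?_) (fun a ha => ?_) ?_,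
    Continuous.subtype_mk (continuous_pi fun a => Complex.continuous_re.comp ?_) _,
    fun s hs χ => ?_⟩
  · obtain ⟨ω, rfl⟩ := X.evalSpectrum_surjective χ
    rw [hφ]
    exact hN0 a _
  · obtain ⟨ω, rfl⟩ := X.evalSpectrum_surjective χ
    rw [hφ, hNF a ha]
  · obtain ⟨ω, rfl⟩ := X.evalSpectrum_surjective χ
    simp only [hφ, hN1]
  · exact (WeakDual.eval_continuous (φ a)).comp continuous_subtype_val
  · obtain ⟨ω, rfl⟩ := X.evalSpectrum_surjective χ
    refine l1Dist_le_of_forall_sum fun T => ?_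
    have h1 : ∀ a, Tendsto (fun g => (ν (s * g)).1 a) ω.1 (𝓝 (N a (X.leftMap s ω).1)) :=
      fun a => hN a (ω.1.map fun g => s * g)
    have h2 : Tendsto (fun g => ∑ a ∈ T, |(ν (s * g)).1 a - (ν g).1 (s⁻¹ * a)|) ω.1
        (𝓝 (∑ a ∈ T, |N a (X.leftMap s ω).1 - N (s⁻¹ * a) ω.1|)) :=
      tendsto_finsetSum T fun a _ => ((h1 a).sub (hN _ ω.1)).abs
    have h3 := le_of_tendsto h2 (Eventually.of_forall fun g =>
      (sum_abs_sub_le_l1Dist (ν (s * g)) (translate s (ν g)) T).trans (hE s hs g))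
    rw [← evalSpectrum_leftMap]
    simpa only [DiscreteProb.translate_apply, ofFinset, hφ] using h3

/-- Extending by Tietze's theorem the maps that witness amenability of the spectrum, one obtains
maps on `Γ` that are asymptotically almost equivariant at `X`. -/
theorem IsBiExact.exists_eventually_equivariant {X : BoundaryPiece Γ} (hX : X.carrier.Nonempty)
    (hb : X.IsBiExact) (E : Finset Γ) {ε : ℝ} (hε : 0 < ε) : ∃ ν : Γ → DiscreteProb Γ,
      (∀ s ∈ E, ∀ᶠ g in X.filter, l1Dist (ν (s * g)) (translate s (ν g)) ≤ ε) ∧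
      ∀ t, Tendsto (fun g => l1Dist (ν (g * t)) (ν g)) X.filter (𝓝 0) := by
  classical
  obtain ⟨F, P, hPc, hPF, hPE⟩ := IsAmenableAction.exists_finite_support hb E
    (show 0 < ε / 2 by positivity)
  obtain ⟨ω₀, hω₀⟩ := hX
  have hP1 : ∀ x, ∑ a ∈ F, (P x).1 a = 1 := fun x => sum_eq_one (hPF x)
  obtain ⟨a₀, ha₀⟩ : F.Nonempty := by
    rw [Finset.nonempty_iff_ne_empty]
    rintro rfl
    simpa using hP1 (X.evalSpectrum ⟨ω₀, hω₀⟩)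
  have hex : ∀ a, ∃ e : C(Ultrafilter Γ, ℝ), ∀ ω : X.carrier, e ω.1 = (P (X.evalSpectrum ω)).1 a :=
    fun a => by
      obtain ⟨e, he⟩ := ContinuousMap.exists_restrict_eq X.isClosed
        (⟨fun ω => (P (X.evalSpectrum ω)).1 a,
          (continuous_coe_apply a).comp (hPc.comp X.evalSpectrum.continuous)⟩ : C(X.carrier, ℝ))
      exact ⟨e, fun ω => DFunLike.congr_fun he ω⟩
  choose e he using hex
  -- positive parts, with the missing mass added at `a₀` and the excess removed by scaling
  let S : Ultrafilter Γ → ℝ := fun ω => ∑ a ∈ F, max (e a ω) 0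
  let N : Γ → Ultrafilter Γ → ℝ := fun a ω => if a ∈ F then
    (max (e a ω) 0 + if a = a₀ then max (1 - S ω) 0 else 0) / max (S ω) 1 else 0
  have hSc : Continuous S := continuous_finsetSum F fun a _ => (e a).continuous.max continuous_const
  have hNc : ∀ a, Continuous (N a) := fun a => by
    have hpos : ∀ ω, max (S ω) 1 ≠ 0 := fun ω => (lt_max_of_lt_right one_pos).ne'
    simp only [N]
    split_ifs
    · exact (((e a).continuous.max continuous_const).add
        ((continuous_const.sub hSc).max continuous_const)).div (hSc.max continuous_const) hpos
    · exact (((e a).continuous.max continuous_const).add continuous_const).div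
        (hSc.max continuous_const) hpos
    · exact continuous_const
  have hNX : ∀ a (ω : X.carrier), N a ω.1 = (P (X.evalSpectrum ω)).1 a := fun a ω => by
    have hmax : ∀ b, max (e b ω.1) 0 = (P (X.evalSpectrum ω)).1 b := fun b => by
      rw [he, max_eq_left ((P _).2.1 b)]
    have hS : S ω.1 = 1 := by simp only [S, hmax, hP1]
    simp only [N, hS, hmax]
    by_cases ha : a ∈ F
    · simp [ha]
    · rw [if_neg ha, hPF _ a ha]
  let ν : Γ → DiscreteProb Γ := fun g => ofFinset F (fun a => N a (pure g))
    (fun a => by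
      simp only [N]
      split_ifs <;> positivity)
    (fun a ha => if_neg ha)
    (by
      rw [Finset.sum_congr rfl fun a ha => if_pos ha, ← Finset.sum_div, Finset.sum_add_distrib,
        Finset.sum_ite_eq' F a₀, if_pos ha₀]
      change (S _ + max (1 - S _) 0) / max (S _) 1 = 1
      rw [← max_add_add_left, add_sub_cancel, add_zero, max_comm, div_self]
      exact (lt_max_of_lt_right one_pos).ne')
  have hνF : ∀ g, ∀ a ∉ F, (ν g).1 a = 0 := fun g a ha => if_neg ha
  have hlim : ∀ a (ω : Ultrafilter Γ), Tendsto (fun g => (ν g).1 a) ω (𝓝 (N a ω)) := fun a ω =>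
    ((hNc a).tendsto ω).comp (Ultrafilter.tendsto_pure_self ω)
  refine ⟨ν, fun s hs => ?_, fun t => ?_⟩
  · refine X.mem_filter.2 fun ω hω => ?_
    let ω' : X.carrier := ⟨ω, hω⟩
    let T := F ∪ F.image (s * ·)
    have hT : ∀ {p q : DiscreteProb Γ}, (∀ a ∉ F, p.1 a = 0) → (∀ a ∉ F, q.1 a = 0) →
        l1Dist p (translate s q) = ∑ a ∈ T, |p.1 a - q.1 (s⁻¹ * a)| := fun hp hq =>
      l1Dist_eq_sum (fun a ha => hp a fun h => ha (Finset.mem_union_left _ h))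
        fun a ha => translate_eq_zero hq s a fun h => ha (Finset.mem_union_right _ h)
    have h1 : ∀ a, Tendsto (fun g => (ν (s * g)).1 a) ω (𝓝 (N a (X.leftMap s ω').1)) :=
      fun a => hlim a (ω.map fun g => s * g)
    have h2 : Tendsto (fun g => l1Dist (ν (s * g)) (translate s (ν g))) ω
        (𝓝 (l1Dist (P (X.evalSpectrum (X.leftMap s ω')))
          (translate s (P (X.evalSpectrum ω'))))) := by
      simp only [hT (hνF _) (hνF _), hT (hPF _) (hPF _), ← hNX]
      exact tendsto_finsetSum T fun a _ => ((h1 a).sub (hlim _ ω)).abs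
    refine h2.eventually (ge_mem_nhds (lt_of_le_of_lt ?_ (half_lt_self hε)))
    rw [evalSpectrum_leftMap]
    exact hPE s hs _
  · refine tendsto_l1Dist (fun g => hνF _) hνF fun a _ => X.tendsto_filter.2 fun ω hω => ?_
    let ω' : X.carrier := ⟨ω, hω⟩
    have h1 : Tendsto (fun g => (ν (g * t)).1 a) ω (𝓝 (N a (X.rightMap t ω').1)) :=
      hlim a (ω.map fun g => g * t)
    have h2 := h1.sub (hlim a ω)
    rwa [hNX a (X.rightMap t ω'), hNX a ω', evalSpectrum_rightMap, sub_self] at h2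

end BoundaryPiece

/-! ### Comparison with proximal pieces -/

section proximal

variable {Γ : Type u} [Group Γ]

/-- Averaging the maps that witness amenability over the translates of `η` gives boundary maps. -/
theorem BoundaryPiece.hasBoundaryMaps_of_subset_proximalPiece (X : BoundaryPiece Γ)
    {K : Type*} [TopologicalSpace K] [CompactSpace K] [MulAction Γ K] [ContinuousConstSMul Γ K]
    [MeasurableSpace K] [BorelSpace K] {η : Measure K} [IsProbabilityMeasure η]
    (hK : IsAmenableAction Γ K) (hX : X.carrier ⊆ proximalPiece Γ η) : X.HasBoundaryMaps := by
  classical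
  intro E ε hε
  obtain ⟨F, P, hPc, hPF, hPE⟩ := hK.exists_finite_support E hε
  have hc : ∀ (g : Γ) a, Continuous fun x : K => (P (g • x)).1 a := fun g a =>
    (continuous_coe_apply a).comp (hPc.comp (continuous_const_smul g))
  have hi : ∀ {f : K → ℝ}, Continuous f → Integrable f η := fun hf =>
    hf.integrable_of_hasCompactSupport (HasCompactSupport.of_compactSpace _)
  let ν : Γ → DiscreteProb Γ := fun g => ofFinset F (fun a => ∫ x, (P (g • x)).1 a ∂η)
    (fun a => integral_nonneg fun x => (P _).2.1 a) (fun a ha => by simp [hPF _ a ha])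
    (by
      rw [← integral_finsetSum F fun a _ => hi (hc g a)]
      simp [sum_eq_one (hPF _)])
  have hν : ∀ g a, (ν g).1 a = ∫ x, (P (g • x)).1 a ∂η := fun _ _ => rfl
  have hνF : ∀ g, ∀ a ∉ F, (ν g).1 a = 0 := fun g a ha => by simp [hν, hPF _ a ha]
  refine ⟨F, ν, hνF, fun s hs g => l1Dist_le_of_forall_sum fun T => ?_, fun t => ?_⟩
  · have hd : ∀ a, Continuous fun x => |(P ((s * g) • x)).1 a - (P (g • x)).1 (s⁻¹ * a)| := fun a =>
      ((hc _ a).sub (hc _ _)).abs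
    calc ∑ a ∈ T, |(ν (s * g)).1 a - (ν g).1 (s⁻¹ * a)|
        ≤ ∑ a ∈ T, ∫ x, |(P ((s * g) • x)).1 a - (P (g • x)).1 (s⁻¹ * a)| ∂η := by
          refine Finset.sum_le_sum fun a _ => ?_
          rw [hν, hν, ← integral_sub (hi (hc _ _)) (hi (hc _ _))]
          exact abs_integral_le_integral_abs
      _ = ∫ x, ∑ a ∈ T, |(P ((s * g) • x)).1 a - (P (g • x)).1 (s⁻¹ * a)| ∂η :=
          (integral_finsetSum T fun a _ => hi (hd a)).symm
      _ ≤ ∫ _, ε ∂η := by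
          refine integral_mono (hi (continuous_finsetSum T fun a _ => hd a)) (integrable_const _)
            fun x => ?_
          have h1 := hPE s hs (g • x)
          rw [← mul_smul] at h1
          exact (sum_abs_sub_le_l1Dist (P ((s * g) • x)) (translate s (P (g • x))) T).trans h1
      _ = ε := by simp
  · refine tendsto_l1Dist (fun g => hνF _) hνF fun a _ => X.tendsto_filter.2 fun ω hω => ?_
    let f : C(K, ℂ) := ⟨fun x => ((P x).1 a : ℂ),
      Complex.continuous_ofReal.comp ((continuous_coe_apply a).comp hPc)⟩
    have hf : ∀ g : Γ, ∫ x, f x ∂(η.map fun x => g • x) = ((ν g).1 a : ℂ) := fun g => by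
      rw [integral_map (continuous_const_smul g).measurable.aemeasurable
        f.continuous.aestronglyMeasurable, hν]
      exact integral_ofReal
    have h := hX hω t f
    simp only [hf] at h
    have h2 := (Complex.continuous_re.tendsto 0).comp h
    simpa [Function.comp_def] using h2

/-- The closed set of the families `z` of probability measures `z k n`, supported in `F n`, that
are equivariant in `k ∈ Γ` up to `1 / (j + 1)` for the elements of `S`, where `n = (S, j)`. -/
def modelSet (F : Finset Γ × ℕ → Finset Γ) : Set (Γ → Finset Γ × ℕ → Γ → ℝ) :=
  {z | ∀ k n, (∀ a, 0 ≤ z k n a) ∧ (∀ a ∉ F n, z k n a = 0) ∧ ∑ a ∈ F n, z k n a = 1 ∧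
    ∀ s ∈ n.1, ∀ T : Finset Γ, ∑ a ∈ T, |z (s * k) n a - z k n (s⁻¹ * a)| ≤ 1 / ((n.2 : ℝ) + 1)}

theorem isClosed_modelSet (F : Finset Γ × ℕ → Finset Γ) : IsClosed (modelSet F) := by
  have hc : ∀ k n a, Continuous fun z : Γ → Finset Γ × ℕ → Γ → ℝ => z k n a := fun k n a => by
    fun_prop
  simp only [modelSet, Set.ofPred_forall, Set.ofPred_and]
  refine isClosed_iInter fun k => isClosed_iInter fun n => ?_
  refine (isClosed_iInter fun a => isClosed_le continuous_const (hc k n a)).inter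
    ((isClosed_iInter fun a => isClosed_iInter fun _ =>
      isClosed_eq (hc k n a) continuous_const).inter
    ((isClosed_eq (continuous_finsetSum _ fun a _ => hc k n a) continuous_const).inter
    (isClosed_iInter fun s => isClosed_iInter fun _ => isClosed_iInter fun T =>
      isClosed_le (continuous_finsetSum _ fun a _ => ((hc _ n a).sub (hc k n _)).abs)
        continuous_const)))

theorem isCompact_modelSet (F : Finset Γ × ℕ → Finset Γ) : IsCompact (modelSet F) := by
  have h : IsCompact (Set.univ.pi fun _ : Γ => Set.univ.pi fun _ : Finset Γ × ℕ =>
      Set.univ.pi fun _ : Γ => Set.Icc (0 : ℝ) 1) :=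
    isCompact_univ_pi fun _ => isCompact_univ_pi fun _ => isCompact_univ_pi fun _ => isCompact_Icc
  refine h.of_isClosed_subset (isClosed_modelSet F) fun z hz k _ n _ a _ => ?_
  obtain ⟨h0, hF, h1, -⟩ := hz k n
  refine ⟨h0 a, ?_⟩
  by_cases ha : a ∈ F n
  · rw [← h1]
    exact Finset.single_le_sum (fun b _ => h0 b) ha
  · rw [hF a ha]
    exact zero_le_one

/-- The compact space of the families in `modelSet F`, with the action `(g z)(k) = z(k g)`. -/
def ModelSpace (F : Finset Γ × ℕ → Finset Γ) : Type u := modelSet F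

namespace ModelSpace

variable (F : Finset Γ × ℕ → Finset Γ)

instance : TopologicalSpace (ModelSpace F) := inferInstanceAs (TopologicalSpace (modelSet F))

instance : T2Space (ModelSpace F) := inferInstanceAs (T2Space (modelSet F))

instance : CompactSpace (ModelSpace F) := isCompact_iff_compactSpace.1 (isCompact_modelSet F)

theorem isInducing_val : IsInducing fun z : ModelSpace F => z.1 := IsInducing.subtypeVal

instance : MulAction Γ (ModelSpace F) where
  smul g z := ⟨fun k => z.1 (k * g), fun k n => by
    obtain ⟨h0, h1, h2, h3⟩ := z.2 (k * g) n
    refine ⟨h0, h1, h2, fun s hs T => ?_⟩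
    have h4 := h3 s hs T
    rw [← mul_assoc] at h4
    exact h4⟩
  one_smul z := Subtype.ext (funext fun k => congrArg z.1 (mul_one k))
  mul_smul g h z := Subtype.ext (funext fun k => congrArg z.1 (mul_assoc k g h).symm)

theorem smul_apply (g : Γ) (z : ModelSpace F) (k : Γ) : (g • z).1 k = z.1 (k * g) := rfl

instance : ContinuousConstSMul Γ (ModelSpace F) where
  continuous_const_smul g := (isInducing_val F).continuous_iff.2
    (continuous_pi fun k => (continuous_apply (k * g)).comp (isInducing_val F).continuous)

instance : MeasurableSpace (ModelSpace F) := borel _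

instance : BorelSpace (ModelSpace F) := ⟨rfl⟩

theorem isAmenableAction : IsAmenableAction Γ (ModelSpace F) := by
  intro E ε hε
  obtain ⟨j, hj⟩ := exists_nat_one_div_lt hε
  refine ⟨fun z => ofFinset (F (E, j)) (z.1 1 (E, j)) (z.2 1 (E, j)).1 (z.2 1 (E, j)).2.1
    (z.2 1 (E, j)).2.2.1, ?_, fun g hg z => l1Dist_le_of_forall_sum fun T => ?_⟩
  · exact ((continuous_apply (E, j)).comp
      ((continuous_apply (1 : Γ)).comp (isInducing_val F).continuous)).subtype_mk _
  · refine le_trans (le_of_eq ?_) (((z.2 1 (E, j)).2.2.2 g hg T).trans hj.le)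
    refine Finset.sum_congr rfl fun a _ => ?_
    rw [mul_one]
    change |(g • z).1 1 (E, j) a - z.1 1 (E, j) (g⁻¹ * a)| = _
    rw [smul_apply, one_mul]

end ModelSpace

theorem regular_dirac {K : Type*} [TopologicalSpace K] [T1Space K] [MeasurableSpace K]
    [BorelSpace K] (x : K) : (Measure.dirac x).Regular where
  lt_top_of_isCompact _ _ := measure_lt_top _ _
  outerRegular A hA r hr := by
    by_cases hx : x ∈ A
    · refine ⟨Set.univ, Set.subset_univ _, isOpen_univ, ?_⟩
      rwa [Measure.dirac_apply_of_mem hx, ← measure_univ (μ := Measure.dirac x)] at hr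
    · refine ⟨{x}ᶜ, Set.subset_compl_singleton_iff.2 hx, isOpen_compl_singleton, ?_⟩
      rw [Measure.dirac_apply' _ isOpen_compl_singleton.measurableSet]
      simpa using bot_le.trans_lt hr
  innerRegular U hU r hr := by
    by_cases hx : x ∈ U
    · refine ⟨{x}, Set.singleton_subset_iff.2 hx, isCompact_singleton, ?_⟩
      rw [Measure.dirac_apply_of_mem hx] at hr
      rwa [Measure.dirac_apply_of_mem (Set.mem_singleton x)]
    · rw [Measure.dirac_apply' _ hU.measurableSet] at hr
      simp [hx] at hr

/-- Boundary maps `ν_n` define a point `x₀(k)(n) = ν_n(k)` of a model space. As `g → ω ∈ X`, the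
points `g x₀` and `(g h) x₀` have the same limit, so `X` lies in the proximal piece of the point
mass at `x₀`. -/
theorem BoundaryPiece.HasBoundaryMaps.exists_amenable_proximal {X : BoundaryPiece Γ}
    (hX : X.HasBoundaryMaps) :
    ∃ (K : Type u) (_ : TopologicalSpace K) (_ : CompactSpace K) (_ : T2Space K)
      (_ : MulAction Γ K) (_ : ContinuousConstSMul Γ K) (_ : MeasurableSpace K)
      (_ : BorelSpace K) (η : Measure K),
      IsAmenableAction Γ K ∧ IsProbabilityMeasure η ∧ η.Regular ∧
        X.carrier ⊆ proximalPiece Γ η := by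
  choose F ν hF hE hR using fun n : Finset Γ × ℕ =>
    hX n.1 (1 / ((n.2 : ℝ) + 1)) (by positivity)
  let x₀ : ModelSpace F := ⟨fun k n => (ν n k).1, fun k n => ⟨(ν n k).2.1, hF n k,
    sum_eq_one (hF n k), fun s hs T =>
      (sum_abs_sub_le_l1Dist (ν n (s * k)) (translate s (ν n k)) T).trans (hE n s hs k)⟩⟩
  refine ⟨ModelSpace F, inferInstance, inferInstance, inferInstance, inferInstance, inferInstance,
    inferInstance, inferInstance, Measure.dirac x₀, ModelSpace.isAmenableAction F, inferInstance,
    regular_dirac x₀, fun ω hω h f => ?_⟩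
  have hint : ∀ g : Γ, ∫ x, f x ∂((Measure.dirac x₀).map fun x => g • x) = f (g • x₀) := fun g => by
    rw [integral_map (continuous_const_smul g).measurable.aemeasurable
      f.continuous.aestronglyMeasurable, integral_dirac]
  simp only [hint]
  obtain ⟨z, -, hz⟩ := isCompact_univ.ultrafilter_le_nhds (ω.map fun g => g • x₀) (by simp)
  have hz1 : Tendsto (fun g : Γ => g • x₀) ω (𝓝 z) := hz
  have hv := ModelSpace.isInducing_val F
  have hz2 : Tendsto (fun g : Γ => (g * h) • x₀) ω (𝓝 z) := by
    refine hv.tendsto_nhds_iff.2 (tendsto_pi_nhds.2 fun k => tendsto_pi_nhds.2 fun n =>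
      tendsto_pi_nhds.2 fun a => ?_)
    have h1 : Tendsto (fun g => (ν n (k * g)).1 a) ω (𝓝 (z.1 k n a)) :=
      tendsto_pi_nhds.1 (tendsto_pi_nhds.1 (tendsto_pi_nhds.1 (hv.tendsto_nhds_iff.1 hz1) k) n) a
    have h2 : Tendsto (fun g => (ν n (k * g * h)).1 a - (ν n (k * g)).1 a) ω (𝓝 0) := by
      refine squeeze_zero_norm (fun g => ?_)
        (X.tendsto_filter.1 ((hR n h).comp (X.tendsto_mul_left k)) ω hω)
      simpa using sum_abs_sub_le_l1Dist (ν n (k * g * h)) (ν n (k * g)) {a}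
    have h3 := h2.add h1
    simp only [sub_add_cancel, zero_add] at h3
    refine h3.congr fun g => ?_
    rw [mul_assoc]
    rfl
  have h4 := ((f.continuous.tendsto z).comp hz2).sub ((f.continuous.tendsto z).comp hz1)
  rwa [sub_self] at h4

end proximal

theorem mainTheorem10 {Γ : Type u} [Group Γ] [Countable Γ] (X : BoundaryPiece Γ)
    (hX : X.carrier.Nonempty) :
    List.TFAE [
      X.IsBiExact,
      ∃ (K : Type u) (_ : TopologicalSpace K) (_ : CompactSpace K) (_ : T2Space K)
        (_ : MulAction Γ K) (_ : ContinuousConstSMul Γ K) (_ : MeasurableSpace K)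
        (_ : BorelSpace K) (η : Measure K),
        IsAmenableAction Γ K ∧ IsProbabilityMeasure η ∧ η.Regular ∧
          X.carrier ⊆ proximalPiece Γ η,
      IsExactGroup Γ ∧ ∃ μ : Γ → DiscreteProb Γ, ∀ (s t : Γ), ∀ ω ∈ X.carrier,
        Tendsto
          (fun g : Γ =>
            DiscreteProb.l1Dist (μ (s * g * t)) (DiscreteProb.translate s (μ g)))
          (ω : Filter Γ) (𝓝 0)] := by
  tfae_have 1 → 3 := by
    intro h
    have : Nonempty X.Spectrum := ⟨X.evalSpectrum ⟨_, hX.some_mem⟩⟩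
    refine ⟨h.hasPropertyA.isExactGroup, ?_⟩
    obtain ⟨μ, hμ⟩ := exists_asymptotically_equivariant X.tendsto_mul_left X.tendsto_mul_right
      X.compl_singleton_mem_filter fun E ε hε => by
        obtain ⟨ν, hν, hνr⟩ := h.exists_eventually_equivariant hX E (half_pos hε)
        refine ⟨ν, fun s hs t _ => ?_⟩
        have h1 := ((hνr t).comp (X.tendsto_mul_left s)).eventually (ge_mem_nhds (half_pos hε))
        filter_upwards [hν s hs, h1] with g h2 h3
        simp only [Function.comp_apply] at h3
        linarith [l1Dist_triangle (ν (s * g * t)) (ν (s * g)) (translate s (ν g))]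
    exact ⟨μ, fun s t => X.tendsto_filter.1 (hμ s t)⟩
  tfae_have 3 → 2 := by
    rintro ⟨h, μ, hμ⟩
    exact (X.hasBoundaryMaps_of_hasPropertyA h.hasPropertyA
      fun s t => X.tendsto_filter.2 (hμ s t)).exists_amenable_proximal
  tfae_have 2 → 1 := by
    rintro ⟨K, _, _, _, _, _, _, _, η, hK, _, -, hη⟩
    exact (X.hasBoundaryMaps_of_subset_proximalPiece hK hη).isBiExact
  tfae_finish

end
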